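/- **Conventions.** Digraphs are finite, without loops or multiple edges; both $(u,v)$ and $(v,u)$ may be edges. For $\star\in\{\rightarrow,\leftarrow\}$ let $(uv)^{\rightarrow}=(u,v)$ and $(uv)^{\leftarrow}=(v,u)$. For an edge-colored digraph $D$, let $\mathcal C(D)$ be the set of colors on its edges, $E_c(D)$ the set of its edges of color $c$, $N^\star(v)=\{u:(vu)^\star\in E(D)\}$, $N^\star_c(v)=\{u:(vu)^\star\in E_c(D)\}$, and $\mathcal C^\star(v)$ the set of colors of the edges $(vu)^\star$ of $D$. A path of length $k$ with orientation $\star\in\{\rightarrow,\leftarrow\}^k$ consists of distinct vertices $v_1,\dots,v_{k+1}$ and the edges $(v_iv_{i+1})^{\star_i}$, $1\le i\le k$; it is rainbow if these edges have distinct colors. **Absorbers.** For a set $S$ of vertices and/or colors, $V(S)$ and $\mathcal C(S)$ are the sets of its vertices and of its colors. Let $\mathcal S$ be a finite collection of such sets, all with the same $|V(S)|$ and the same $|\mathcal C(S)|$, and let $\star\in\{\rightarrow,\leftarrow\}^k$ with $k\ge1$. An $(\mathcal S,\star)$-absorber in $D$ is a colored subdigraph $A\subseteq D$ with two vertices $s,t\in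 V(A)$ such that for every $S\in\mathcal S$ there is a rainbow path $P_S$ in $A$ from $s$ to $t$ with orientation $\star$, with $V(P_S)=(V(A)\setminus V(\bigcup\mathcal S))\cup V(S)$ and $\mathcal C(P_S)=(\mathcal C(A)\setminus\mathcal C(\bigcup\mathcal S))\cup\mathcal C(S)$. Its internal vertices are those in $V(A)\setminus V(\bigcup\mathcal S)$ and its internal colors those in $\mathcal C(A)\setminus\mathcal C(\bigcup\mathcal S)$. **Pseudorandomness.** $D$ is $(n,\alpha,\varepsilon)$-edge-color pseudorandom if 1. $|V(D)|=|\mathcal C(D)|=n$, and $|N^\star(v)|\ge\alpha n$ for all $v\in V(D)$ and $\star\in\{\rightarrow,\leftarrow\}$; 2. for all $U,W\subseteq V(D)$ and $\mathcal C'\subseteq\mathcal C(D)$ of size at least $\varepsilon n$ and all $\star\in\{\rightarrow,\leftarrow\}$, there are $u\in U$, $w\in W$ such that $(uw)^\star$ is an edge with color in $\mathcal C'$; 3. $|N^\star_c(v)|\le n/\log n$ for all $c\in\mathcal C(D)$, $v\in V(D)$, $\star\in\{\rightarrow,\leftarrow\}$; 4. for every $c\in\mathcal C(D)$, $E_c(D)$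 contains a matching (a set of pairwise vertex-disjoint edges) of size at least $\alpha n/3$; 5. $|E_c(D)|\le 10n$ for every $c\in\mathcal C(D)$; 6. $|\mathcal C^\star(v)|\ge\alpha n/2$ for all $v\in V(D)$ and $\star\in\{\rightarrow,\leftarrow\}$. An $n$-vertex $D$ is $\nu$-color-gadget pseudorandom if for all $V'\subseteq V(D)$ and $\mathcal C'\subseteq\mathcal C(D)$ with $|V'|,|\mathcal C'|\ge(1-\nu)n$, all $c_1,c_2\in\mathcal C(D)$ and all $\star\in\{\rightarrow,\leftarrow\}^7$, there is a $(\{\{c_1\},\{c_2\}\},\star)$-absorber in $D$ with internal vertices in $V'$ and internal colors in $\mathcal C'$. **Lemma (Vertex Global Absorber).** For every $\alpha\in(0,1]$ there is $\nu_0>0$ such that for every $\nu\in(0,\nu_0]$ there is $\mu_0>0$ such that for all $0<\beta\le\mu\le\mu_0$ there is $\varepsilon_0>0$ such that for every $\varepsilon\in(0,\varepsilon_0]$ there is $n_0$ such that the following holds for every $n\ge n_0$. Put $m=\lfloor\mu n\rfloor$ and $b=\lfloor\beta n\rfloor$ (so $m=\mu n$ and $b=\beta n$ if these are integers). Let $D$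 be an $(n,\alpha,\varepsilon)$-edge-color pseudorandom and $4\nu$-color-gadget pseudorandom digraph, and let $\star\in\{\rightarrow,\leftarrow\}^{2825\cdot 3m-3}$. Then for all $V'\subseteq V(D)$ and $\mathcal C'\subseteq\mathcal C(D)$ with $|V'|,|\mathcal C'|\ge(1-\nu)n$ and every $X\subseteq V(D)$ with $|X|=m+b$, there is a $(\binom{X}{m},\star)$-absorber in $D$ with internal vertices in $V'$ and internal colors in $\mathcal C'$, where $\binom{X}{m}$ is the collection of all $m$-element subsets of $X$. -/

import Mathlib

/-- The two possible directions of an arc in an orientation pattern. -/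
inductive Dir : Type
  | fwd : Dir
  | bwd : Dir

/-- `arc d u v` is the ordered pair `(uv)^d`: the pair `(u, v)` (edge from `u` to `v`) if `d` is
forward, and the pair `(v, u)` if `d` is backward. -/
def arc {V : Type*} (d : Dir) (u v : V) : V × V :=
  match d with
  | Dir.fwd => (u, v)
  | Dir.bwd => (v, u)

/-- A finite edge-colored digraph without loops or multiple edges (opposite edges `(u, v)` and
`(v, u)` may both be present). The values of `color` outside `edges` carry no meaning and are
never used. -/
structure ColoredDigraph (V C : Type*) where
  verts : Finset V
  edges : Finset (V × V)
  color : V × V → C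
  mem_verts : ∀ e ∈ edges, e.1 ∈ verts ∧ e.2 ∈ verts
  loopless : ∀ e ∈ edges, e.1 ≠ e.2

namespace ColoredDigraph

variable {V C : Type*} [DecidableEq V] [DecidableEq C]

/-- `A` is a (colored) subdigraph of `D`. -/
def IsSubdigraph {V C : Type*} (A D : ColoredDigraph V C) : Prop :=
  A.verts ⊆ D.verts ∧ A.edges ⊆ D.edges ∧ ∀ e ∈ A.edges, A.color e = D.color e

/-- The set of colors appearing on the edges of `D`. -/
def colors (D : ColoredDigraph V C) : Finset C := D.edges.image D.color

/-- The set of edges of color `c`. -/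
def colorClass (D : ColoredDigraph V C) (c : C) : Finset (V × V) :=
  D.edges.filter fun e => D.color e = c

/-- The neighborhood `N^d(v) = {u : (vu)^d ∈ E(D)}`. -/
def nbhd (D : ColoredDigraph V C) (d : Dir) (v : V) : Finset V :=
  D.verts.filter fun u => arc d v u ∈ D.edges

/-- The neighborhood `N^d_c(v)` through edges of color `c`. -/
def colorNbhd (D : ColoredDigraph V C) (d : Dir) (c : C) (v : V) : Finset V :=
  (D.nbhd d v).filter fun u => D.color (arc d v u) = c

/-- The set of colors on edges of the form `(vu)^d`. -/
def colorsAt (D : ColoredDigraph V C) (d : Dir) (v : V) : Finset C :=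
  (D.nbhd d v).image fun u => D.color (arc d v u)

/-- A matching: a set of pairwise vertex-disjoint edges. -/
def IsMatching {V : Type*} (M : Finset (V × V)) : Prop :=
  ∀ e ∈ M, ∀ f ∈ M, e ≠ f → e.1 ≠ f.1 ∧ e.1 ≠ f.2 ∧ e.2 ≠ f.1 ∧ e.2 ≠ f.2

/-- `(n, α, ε)`-edge-color pseudorandomness. -/
structure IsPseudorandom (D : ColoredDigraph V C) (n : ℕ) (α ε : ℝ) : Prop where
  card_verts : D.verts.card = n
  card_colors : D.colors.card = n
  /-- minimum semi-degree at least `α n` -/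
  min_semidegree : ∀ v ∈ D.verts, ∀ d : Dir, α * n ≤ ((D.nbhd d v).card : ℝ)
  exists_edge : ∀ U ⊆ D.verts, ∀ W ⊆ D.verts, ∀ K ⊆ D.colors,
    ε * n ≤ (U.card : ℝ) → ε * n ≤ (W.card : ℝ) → ε * n ≤ (K.card : ℝ) →
    ∀ d : Dir, ∃ u ∈ U, ∃ w ∈ W, arc d u w ∈ D.edges ∧ D.color (arc d u w) ∈ K
  color_degree_le : ∀ c ∈ D.colors, ∀ v ∈ D.verts, ∀ d : Dir,
    ((D.colorNbhd d c v).card : ℝ) ≤ n / Real.log n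
  exists_matching : ∀ c ∈ D.colors, ∃ M ⊆ D.colorClass c,
    IsMatching M ∧ α * n / 3 ≤ (M.card : ℝ)
  card_colorClass_le : ∀ c ∈ D.colors, (D.colorClass c).card ≤ 10 * n
  color_diversity : ∀ v ∈ D.verts, ∀ d : Dir, α * n / 2 ≤ ((D.colorsAt d v).card : ℝ)

/-- `p 0, p 1, …, p k` is (the vertex sequence of) a rainbow path in `A` of length `k` with
orientation `o`, starting at `s` and ending at `t`. -/
structure IsRainbowPath {V C : Type*} (A : ColoredDigraph V C) {k : ℕ} (o : Fin k → Dir)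
    (s t : V) (p : Fin (k + 1) → V) : Prop where
  mem_verts : ∀ i, p i ∈ A.verts
  injective : Function.Injective p
  mem_edges : ∀ i : Fin k, arc (o i) (p i.castSucc) (p i.succ) ∈ A.edges
  rainbow : Function.Injective fun i : Fin k => A.color (arc (o i) (p i.castSucc) (p i.succ))
  start : p 0 = s
  finish : p (Fin.last k) = t

/-- The vertex set of a path. -/
def pathVerts {k : ℕ} (p : Fin (k + 1) → V) : Finset V := Finset.univ.image p

/-- The set of colors on the edges of a path with orientation `o`. -/
def pathColors (A : ColoredDigraph V C) {k : ℕ} (o : Fin k → Dir) (p : Fin (k + 1) → V) :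
    Finset C :=
  Finset.univ.image fun i : Fin k => A.color (arc (o i) (p i.castSucc) (p i.succ))

/-- A set consisting of vertices and/or colors is encoded as the pair of its set of vertices and
its set of colors. This is the set of all vertices appearing in a member of the collection `𝒮`. -/
def famVerts (𝒮 : Finset (Finset V × Finset C)) : Finset V := 𝒮.biUnion Prod.fst

/-- The set of all colors appearing in a member of the collection `𝒮`. -/
def famColors (𝒮 : Finset (Finset V × Finset C)) : Finset C := 𝒮.biUnion Prod.snd

/-- `(A, s, t)` is an `(𝒮, o)`-absorber: for every `S ∈ 𝒮` there is a rainbow path from `s` to `t`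
in `A` with orientation `o` which uses all vertices and colors of `A` that do not appear in the
collection `𝒮`, all vertices and colors of `S`, and no others. -/
structure IsAbsorber (𝒮 : Finset (Finset V × Finset C)) {k : ℕ} (o : Fin k → Dir)
    (A : ColoredDigraph V C) (s t : V) : Prop where
  length_pos : 0 < k
  card_verts_eq : ∀ S ∈ 𝒮, ∀ T ∈ 𝒮, S.1.card = T.1.card
  card_colors_eq : ∀ S ∈ 𝒮, ∀ T ∈ 𝒮, S.2.card = T.2.card
  start_mem : s ∈ A.verts
  end_mem : t ∈ A.verts
  exists_path : ∀ S ∈ 𝒮, ∃ p : Fin (k + 1) → V,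
    A.IsRainbowPath o s t p ∧
    pathVerts p = (A.verts \ famVerts 𝒮) ∪ S.1 ∧
    A.pathColors o p = (A.colors \ famColors 𝒮) ∪ S.2

/-- `D` contains an `(𝒮, o)`-absorber with internal vertices in `V'` and internal colors in `C'`. -/
def HasAbsorber (D : ColoredDigraph V C) (𝒮 : Finset (Finset V × Finset C)) {k : ℕ}
    (o : Fin k → Dir) (V' : Finset V) (C' : Finset C) : Prop :=
  ∃ (A : ColoredDigraph V C) (s t : V), A.IsSubdigraph D ∧ IsAbsorber 𝒮 o A s t ∧
    A.verts \ famVerts 𝒮 ⊆ V' ∧ A.colors \ famColors 𝒮 ⊆ C'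

/-- `ν`-color-gadget pseudorandomness of a digraph with `n` vertices: robust existence of
`({c₁, c₂}, o)`-absorbers for all orientations `o` of length `7`. -/
def IsColorGadgetPseudorandom (D : ColoredDigraph V C) (n : ℕ) (ν : ℝ) : Prop :=
  D.verts.card = n ∧
  ∀ V' ⊆ D.verts, ∀ C' ⊆ D.colors,
    (1 - ν) * n ≤ (V'.card : ℝ) → (1 - ν) * n ≤ (C'.card : ℝ) →
    ∀ c₁ ∈ D.colors, ∀ c₂ ∈ D.colors, ∀ o : Fin 7 → Dir,
      D.HasAbsorber {(∅, {c₁}), (∅, {c₂})} o V' C'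

/-- The collection `binom(X, m)` of all `m`-element subsets of the vertex set `X`, viewed as sets
of vertices and colors that contain no color. -/
def vertexSubsets (C : Type*) [DecidableEq C] (X : Finset V) (m : ℕ) :
    Finset (Finset V × Finset C) :=
  (X.powersetCard m).image fun U => (U, ∅)

end ColoredDigraph

/-! ### Rainbow trails, robust availability and chaining. -/

namespace ColoredDigraph

variable {V C : Type*} [DecidableEq V] [DecidableEq C]

/-! The absorber is a chain of `3m` local pieces governed by a sparse bipartite template. Fix `2m`
auxiliary vertices `Y` in `V' \ X` and give each piece a list of 35 vertices of `Y ∪ X` (repetitions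
allowed), such that for every `m`-subset `U` of `X` the pieces can be matched along their lists to
exactly `Y ∪ U` (`exists_robustly_matchable`: Hall's theorem for a graph made of random
permutations). If each piece can absorb any single vertex of its list, with ends and color set
independent of the choice, then linking the pieces in a fixed order gives all the required paths:
`Y` is always used up, and the colors never change.

A local piece has three layers. In a hub, the path `a, w i, b` uses one of the common neighbors `w
i`, and color gadgets absorb the colors belonging to the other choices, so the color set becomes
constant (`IsHub.exists_absorber`). Two arbitrary vertices `v₁`, `v₂` need not lie in a common hub,
so two hubs with options `{v₁, z}` and `{z, v₂}` are chained: one of them takes `z`, and the other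
takes `v₁` or `v₂` (`Rich.avail_pair`). For a list `v`, a new hub on vertices `w` is followed by a
pair piece for each `{v j, w j}`: if the hub takes `w i`, then pair `i` takes `v i` and every other
pair takes `w j` (`Rich.avail_local`).

Everything is found greedily outside the vertices and colors already in use. This is possible
because their number is linear in `m`, which is tiny compared with `ν n`. `Rich` isolates what the
greedy construction needs. In `IsPseudorandom.rich`, links and swaps come from color diversity and
the edge condition, hubs from double counting and the bound on color degrees, and gadgets from the
second hypothesis. -/

/-- A rainbow path of `D` with orientation `o` from `s` to `t`, with vertex set `P` and color
set `Q`. -/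
inductive RainbowTrail (D : ColoredDigraph V C) :
    List Dir → V → V → Finset V → Finset C → Prop
  | single {v : V} (hv : v ∈ D.verts) : RainbowTrail D [] v v {v} ∅
  | cons {d : Dir} {o : List Dir} {u v t : V} {P : Finset V} {Q : Finset C}
      (he : arc d u v ∈ D.edges) (hu : u ∉ P) (hc : D.color (arc d u v) ∉ Q)
      (h : RainbowTrail D o v t P Q) :
      RainbowTrail D (d :: o) u t (insert u P) (insert (D.color (arc d u v)) Q)

variable {D : ColoredDigraph V C} {M : ℕ}

theorem arc_mem_verts {V C : Type*} {D : ColoredDigraph V C} {d : Dir} {u v : V}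
    (h : arc d u v ∈ D.edges) : u ∈ D.verts ∧ v ∈ D.verts := by
  cases d
  · exact D.mem_verts _ h
  · exact (D.mem_verts _ h).symm

theorem arc_ne {V C : Type*} {D : ColoredDigraph V C} {d : Dir} {u v : V}
    (h : arc d u v ∈ D.edges) : u ≠ v := by
  cases d
  · exact D.loopless _ h
  · exact (D.loopless _ h).symm

omit [DecidableEq V] in
theorem color_mem_colors {e : V × V} (h : e ∈ D.edges) : D.color e ∈ D.colors :=
  Finset.mem_image_of_mem _ h

namespace RainbowTrail

theorem congr {o o' : List Dir} {s t : V} {P P' : Finset V} {Q Q' : Finset C}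
    (h : RainbowTrail D o s t P Q) (ho : o = o') (hP : P = P') (hQ : Q = Q') :
    RainbowTrail D o' s t P' Q' := by
  subst ho hP hQ
  exact h

theorem start_mem {o : List Dir} {s t : V} {P : Finset V} {Q : Finset C}
    (h : RainbowTrail D o s t P Q) : s ∈ P := by
  cases h <;> simp

theorem finish_mem {o : List Dir} {s t : V} {P : Finset V} {Q : Finset C}
    (h : RainbowTrail D o s t P Q) : t ∈ P := by
  induction h with
  | single => simp
  | cons _ _ _ _ ih => exact Finset.mem_insert_of_mem ih

theorem subset_verts {o : List Dir} {s t : V} {P : Finset V} {Q : Finset C}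
    (h : RainbowTrail D o s t P Q) : P ⊆ D.verts := by
  induction h with
  | single hv => simpa using hv
  | cons he _ _ _ ih => exact Finset.insert_subset (arc_mem_verts he).1 ih

theorem subset_colors {o : List Dir} {s t : V} {P : Finset V} {Q : Finset C}
    (h : RainbowTrail D o s t P Q) : Q ⊆ D.colors := by
  induction h with
  | single hv => simp
  | cons he _ _ _ ih => exact Finset.insert_subset (color_mem_colors he) ih

theorem card_verts {o : List Dir} {s t : V} {P : Finset V} {Q : Finset C}
    (h : RainbowTrail D o s t P Q) : P.card = o.length + 1 := by
  induction h with
  | single hv => simp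
  | cons he hu _ _ ih => rw [Finset.card_insert_of_notMem hu, ih, List.length_cons]

theorem card_colors {o : List Dir} {s t : V} {P : Finset V} {Q : Finset C}
    (h : RainbowTrail D o s t P Q) : Q.card = o.length := by
  induction h with
  | single hv => simp
  | cons he _ hc _ ih => rw [Finset.card_insert_of_notMem hc, ih, List.length_cons]

/-- Two disjoint rainbow trails can be joined by an edge of a new color. -/
theorem join {o₁ o₂ : List Dir} {s₁ t₁ s₂ t₂ : V} {P₁ P₂ : Finset V} {Q₁ Q₂ : Finset C} {d : Dir}
    (h₁ : RainbowTrail D o₁ s₁ t₁ P₁ Q₁) (he : arc d t₁ s₂ ∈ D.edges)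
    (h₂ : RainbowTrail D o₂ s₂ t₂ P₂ Q₂) (hP : Disjoint P₁ P₂) (hQ : Disjoint Q₁ Q₂)
    (hc₁ : D.color (arc d t₁ s₂) ∉ Q₁) (hc₂ : D.color (arc d t₁ s₂) ∉ Q₂) :
    RainbowTrail D (o₁ ++ d :: o₂) s₁ t₂ (P₁ ∪ P₂)
      (insert (D.color (arc d t₁ s₂)) (Q₁ ∪ Q₂)) := by
  induction h₁ with
  | single hv =>
    refine (cons he (by simpa using hP) hc₂ h₂).congr rfl ?_ ?_ <;> simp
  | cons he' hu hc h ih =>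
    rw [Finset.disjoint_insert_left] at hP hQ
    rw [Finset.mem_insert, not_or] at hc₁
    refine (cons he' ?_ ?_ (ih he hP.2 hQ.2 hc₁.2 hc₂)).congr rfl ?_ ?_
    · simp [hu, hP.1]
    · simp [hc, hQ.1, Ne.symm hc₁.1]
    · simp
    · rw [Finset.insert_union, Finset.insert_comm]

/-- Two disjoint rainbow trails can be joined by a new path of length three. -/
theorem link {o₁ o₂ : List Dir} {s₁ t₁ s₂ t₂ x y : V} {P₁ P₂ : Finset V} {Q₁ Q₂ : Finset C}
    {d₁ d₂ d₃ : Dir} (h₁ : RainbowTrail D o₁ s₁ t₁ P₁ Q₁) (h₂ : RainbowTrail D o₂ s₂ t₂ P₂ Q₂)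
    (he₁ : arc d₁ t₁ x ∈ D.edges) (he₂ : arc d₂ x y ∈ D.edges) (he₃ : arc d₃ y s₂ ∈ D.edges)
    (hP : Disjoint P₁ P₂) (hQ : Disjoint Q₁ Q₂)
    (hx : x ∉ P₁ ∪ P₂) (hy : y ∉ P₁ ∪ P₂)
    (hc₁ : D.color (arc d₁ t₁ x) ∉ Q₁ ∪ Q₂) (hc₂ : D.color (arc d₂ x y) ∉ Q₁ ∪ Q₂)
    (hc₃ : D.color (arc d₃ y s₂) ∉ Q₁ ∪ Q₂)
    (h12 : D.color (arc d₁ t₁ x) ≠ D.color (arc d₂ x y))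
    (h13 : D.color (arc d₁ t₁ x) ≠ D.color (arc d₃ y s₂))
    (h23 : D.color (arc d₂ x y) ≠ D.color (arc d₃ y s₂)) :
    RainbowTrail D (o₁ ++ d₁ :: d₂ :: d₃ :: o₂) s₁ t₂ (P₁ ∪ P₂ ∪ {x, y})
      (Q₁ ∪ Q₂ ∪ {D.color (arc d₁ t₁ x), D.color (arc d₂ x y), D.color (arc d₃ y s₂)}) := by
  rw [Finset.mem_union, not_or] at hx hy hc₁ hc₂ hc₃
  have hxy := arc_ne he₂
  have h3 := cons he₃ hy.2 hc₃.2 h₂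
  have h2 := cons he₂ (by simp [hx.2, hxy]) (by simp [hc₂.2, h23]) h3
  refine (h₁.join he₁ h2 ?_ ?_ hc₁.1 ?_).congr rfl ?_ ?_
  · simp [hx.1, hy.1, hP]
  · simp [hc₂.1, hc₃.1, hQ]
  · simp [hc₁.2, h12, h13]
  · ext; simp
  · ext; simp

end RainbowTrail

/-- For all sufficiently small sets of forbidden vertices and colors and every orientation of
length `ℓ` there are a vertex set `I` and a color set `K` avoiding them such that the vertices
`I ∪ T i` and the colors `K ∪ S i` form a rainbow path, with ends not depending on `i`. -/
def Avail (D : ColoredDigraph V C) (M ℓ : ℕ) {ι : Type*} (T : ι → Finset V) (S : ι → Finset C) :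
    Prop :=
  ∀ (FV : Finset V) (FC : Finset C), FV.card ≤ M → FC.card ≤ M →
    ∀ o : List Dir, o.length = ℓ → ∃ (s t : V) (I : Finset V) (K : Finset C),
      Disjoint I FV ∧ Disjoint K FC ∧ ∀ i, RainbowTrail D o s t (I ∪ T i) (K ∪ S i)

/-- The map `f` may be neither injective nor surjective. It translates a global choice into the
option that one particular piece should take, so pieces with different options can be indexed by the
same type. -/
theorem Avail.comp {ℓ : ℕ} {ι ι' : Type*} {T : ι → Finset V} {S : ι → Finset C}
    (h : Avail D M ℓ T S) (f : ι' → ι) {T' : ι' → Finset V} {S' : ι' → Finset C}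
    (hT : ∀ i, T (f i) = T' i) (hS : ∀ i, S (f i) = S' i) : Avail D M ℓ T' S' := by
  intro FV FC h₁ h₂ o ho
  obtain ⟨s, t, I, K, hI, hK, hp⟩ := h FV FC h₁ h₂ o ho
  exact ⟨s, t, I, K, hI, hK, fun i => hT i ▸ hS i ▸ hp (f i)⟩

/-- Vertices `a`, `b` with common neighbors `w i`, where all edges have distinct colors. -/
structure IsHub (D : ColoredDigraph V C) (d₁ d₂ : Dir) (a b : V) {ι : Type*} (w : ι → V) :
    Prop where
  ne : a ≠ b
  injective : Function.Injective w
  left_mem : ∀ i, arc d₁ a (w i) ∈ D.edges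
  right_mem : ∀ i, arc d₂ (w i) b ∈ D.edges
  left_injective : Function.Injective fun i => D.color (arc d₁ a (w i))
  right_injective : Function.Injective fun i => D.color (arc d₂ (w i) b)
  left_ne_right : ∀ i j, D.color (arc d₁ a (w i)) ≠ D.color (arc d₂ (w j) b)

/-- The colors of the edges of a hub. -/
def hubColors (D : ColoredDigraph V C) (d₁ d₂ : Dir) (a b : V) {ι : Type*} [Fintype ι]
    (w : ι → V) : Finset C :=
  Finset.univ.image (fun i => D.color (arc d₁ a (w i))) ∪
    Finset.univ.image (fun i => D.color (arc d₂ (w i) b))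

/-- The robust properties of a digraph from which absorbers are built: everything can be found
outside any `M` forbidden vertices and `M` forbidden colors. -/
structure Rich (D : ColoredDigraph V C) (M d : ℕ) : Prop where
  link : ∀ (FV : Finset V) (FC : Finset C), FV.card ≤ M → FC.card ≤ M →
    ∀ s ∈ D.verts, ∀ t ∈ D.verts, ∀ d₁ d₂ d₃ : Dir, ∃ x y : V, x ∉ FV ∧ y ∉ FV ∧
      arc d₁ s x ∈ D.edges ∧ arc d₂ x y ∈ D.edges ∧ arc d₃ y t ∈ D.edges ∧
      D.color (arc d₁ s x) ∉ FC ∧ D.color (arc d₂ x y) ∉ FC ∧ D.color (arc d₃ y t) ∉ FC ∧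
      D.color (arc d₁ s x) ≠ D.color (arc d₂ x y) ∧
      D.color (arc d₁ s x) ≠ D.color (arc d₃ y t) ∧
      D.color (arc d₂ x y) ≠ D.color (arc d₃ y t)
  gadget : ∀ c₁ ∈ D.colors, ∀ c₂ ∈ D.colors,
    Avail D M 7 (fun _ : Bool => ∅) (fun b : Bool => {if b then c₁ else c₂})
  swap : ∀ (FV : Finset V) (FC : Finset C), FV.card ≤ M → FC.card ≤ M →
    ∀ v₁ ∈ D.verts, ∀ v₂ ∈ D.verts, ∀ d₁ d₂ e₁ e₂ : Dir, ∃ a₁ b₁ a₂ b₂ z : V,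
      a₁ ∉ FV ∧ b₁ ∉ FV ∧ a₂ ∉ FV ∧ b₂ ∉ FV ∧ z ∉ FV ∧
      Disjoint ({a₁, b₁} : Finset V) {a₂, b₂} ∧
      IsHub D d₁ d₂ a₁ b₁ (fun b : Bool => if b then v₁ else z) ∧
      IsHub D e₁ e₂ a₂ b₂ (fun b : Bool => if b then z else v₂) ∧
      Disjoint (hubColors D d₁ d₂ a₁ b₁ (fun b : Bool => if b then v₁ else z))
        (hubColors D e₁ e₂ a₂ b₂ (fun b : Bool => if b then z else v₂)) ∧
      Disjoint (hubColors D d₁ d₂ a₁ b₁ (fun b : Bool => if b then v₁ else z)) FC ∧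
      Disjoint (hubColors D e₁ e₂ a₂ b₂ (fun b : Bool => if b then z else v₂)) FC
  hub : ∀ (FV : Finset V) (FC : Finset C), FV.card ≤ M → FC.card ≤ M → ∀ d₁ d₂ : Dir,
    ∃ (a b : V) (w : Fin d → V), a ∉ FV ∧ b ∉ FV ∧ (∀ i, w i ∉ FV) ∧
      IsHub D d₁ d₂ a b w ∧ Disjoint (hubColors D d₁ d₂ a b w) FC

variable {d : ℕ}

theorem exists_eq_three_cons {o : List Dir} {ℓ : ℕ} (h : o.length = ℓ + 3) :
    ∃ d₁ d₂ d₃ o', o = d₁ :: d₂ :: d₃ :: o' ∧ o'.length = ℓ := by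
  match o, h with
  | d₁ :: d₂ :: d₃ :: o', h => exact ⟨d₁, d₂, d₃, o', rfl, by simpa using h⟩

/-- Two families of trails with common ends can be joined by a common path of length three. -/
theorem Rich.exists_link (hR : Rich D M d) {ι : Type*} [Nonempty ι] {o₁ o₂ : List Dir}
    {s₁ t₁ s₂ t₂ : V} {P₁ P₂ : ι → Finset V} {Q₁ Q₂ : ι → Finset C}
    (h₁ : ∀ i, RainbowTrail D o₁ s₁ t₁ (P₁ i) (Q₁ i))
    (h₂ : ∀ i, RainbowTrail D o₂ s₂ t₂ (P₂ i) (Q₂ i))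
    (hP : ∀ i, Disjoint (P₁ i) (P₂ i)) (hQ : ∀ i, Disjoint (Q₁ i) (Q₂ i))
    (FV : Finset V) (FC : Finset C) (hFV : FV.card ≤ M) (hFC : FC.card ≤ M)
    (hP₁ : ∀ i, P₁ i ⊆ FV) (hP₂ : ∀ i, P₂ i ⊆ FV) (hQ₁ : ∀ i, Q₁ i ⊆ FC) (hQ₂ : ∀ i, Q₂ i ⊆ FC)
    (d₁ d₂ d₃ : Dir) :
    ∃ (I : Finset V) (K : Finset C), Disjoint I FV ∧ Disjoint K FC ∧ I.card ≤ 2 ∧ K.card ≤ 3 ∧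
      ∀ i, RainbowTrail D (o₁ ++ d₁ :: d₂ :: d₃ :: o₂) s₁ t₂ (P₁ i ∪ P₂ i ∪ I)
        (Q₁ i ∪ Q₂ i ∪ K) := by
  obtain ⟨i₀⟩ := ‹Nonempty ι›
  obtain ⟨x, y, hx, hy, e1, e2, e3, c1, c2, c3, n12, n13, n23⟩ := hR.link FV FC hFV hFC t₁
    ((h₁ i₀).subset_verts (h₁ i₀).finish_mem) s₂ ((h₂ i₀).subset_verts (h₂ i₀).start_mem) d₁ d₂ d₃
  refine ⟨{x, y}, _, ?_, ?_, Finset.card_le_two, Finset.card_le_three, fun i =>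
    (h₁ i).link (h₂ i) e1 e2 e3 (hP i) (hQ i) ?_ ?_ ?_ ?_ ?_ n12 n13 n23⟩
  · simp [hx, hy]
  · simp [c1, c2, c3]
  · exact fun h => hx (Finset.union_subset (hP₁ i) (hP₂ i) h)
  · exact fun h => hy (Finset.union_subset (hP₁ i) (hP₂ i) h)
  · exact fun h => c1 (Finset.union_subset (hQ₁ i) (hQ₂ i) h)
  · exact fun h => c2 (Finset.union_subset (hQ₁ i) (hQ₂ i) h)
  · exact fun h => c3 (Finset.union_subset (hQ₁ i) (hQ₂ i) h)

/-- A family of trails can be extended by robustly available pieces. -/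
theorem Rich.exists_chain (hR : Rich D M d) {ι κ : Type*} [Nonempty ι] [DecidableEq κ]
    (J : Finset κ) (T : κ → ι → Finset V) (S : κ → ι → Finset C) {ℓ M₁ : ℕ} (hM₁ : M₁ ≤ M)
    (hA : ∀ j ∈ J, Avail D M₁ ℓ (T j) (S j)) {o₁ : List Dir} {s t₁ : V} {P : ι → Finset V}
    {Q : ι → Finset C} (hbase : ∀ i, RainbowTrail D o₁ s t₁ (P i) (Q i))
    (FV : Finset V) (FC : Finset C) (hPF : ∀ i, P i ⊆ FV) (hQF : ∀ i, Q i ⊆ FC)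
    (hTF : ∀ j ∈ J, ∀ i, T j i ⊆ FV) (hSF : ∀ j ∈ J, ∀ i, S j i ⊆ FC)
    (hPT : ∀ i, ∀ j ∈ J, Disjoint (P i) (T j i)) (hQS : ∀ i, ∀ j ∈ J, Disjoint (Q i) (S j i))
    (hTT : ∀ i, ∀ j ∈ J, ∀ j' ∈ J, j ≠ j' → Disjoint (T j i) (T j' i))
    (hSS : ∀ i, ∀ j ∈ J, ∀ j' ∈ J, j ≠ j' → Disjoint (S j i) (S j' i))
    (hFV : FV.card + J.card * (ℓ + 3) ≤ M₁) (hFC : FC.card + J.card * (ℓ + 3) ≤ M₁)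
    (o : List Dir) (ho : o.length = J.card * (ℓ + 3)) :
    ∃ (t : V) (I : Finset V) (K : Finset C), Disjoint I FV ∧ Disjoint K FC ∧
      I.card ≤ J.card * (ℓ + 3) ∧ K.card ≤ J.card * (ℓ + 3) ∧
      ∀ i, RainbowTrail D (o₁ ++ o) s t (P i ∪ J.biUnion (fun j => T j i) ∪ I)
        (Q i ∪ J.biUnion (fun j => S j i) ∪ K) := by
  induction J using Finset.induction_on generalizing o with
  | empty =>
    have : o = [] := by simpa using ho
    subst this
    exact ⟨t₁, ∅, ∅, by simp, by simp, by simp, by simp, fun i => by simpa using hbase i⟩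
  | insert j J hj ih =>
    have hc : (insert j J).card * (ℓ + 3) = J.card * (ℓ + 3) + (ℓ + 3) := by
      rw [Finset.card_insert_of_notMem hj]; ring
    rw [hc] at hFV hFC ho
    have hsub : ∀ {k}, k ∈ J → k ∈ insert j J := Finset.mem_insert_of_mem
    obtain ⟨t, I, K, hI, hK, cI, cK, hp⟩ := ih (fun k hk => hA k (hsub hk))
      (fun k hk => hTF k (hsub hk)) (fun k hk => hSF k (hsub hk))
      (fun i k hk => hPT i k (hsub hk)) (fun i k hk => hQS i k (hsub hk))
      (fun i k hk k' hk' => hTT i k (hsub hk) k' (hsub hk'))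
      (fun i k hk k' hk' => hSS i k (hsub hk) k' (hsub hk'))
      (by omega) (by omega) (o.take (J.card * (ℓ + 3))) (by simp [ho])
    -- Three directions go to the link and the remaining `ℓ` to the new piece, hence the length `ℓ +
    -- 3` per step.
    obtain ⟨d₁, d₂, d₃, o₂, ho₂, hlen⟩ := exists_eq_three_cons
      (show (o.drop (J.card * (ℓ + 3))).length = ℓ + 3 by simp [ho])
    have cFI := Finset.card_union_le FV I
    have cFK := Finset.card_union_le FC K
    obtain ⟨s₂, t₂, I₂, K₂, hI₂, hK₂, hp₂⟩ := hA j (Finset.mem_insert_self j J)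
      (FV ∪ I) (FC ∪ K) (by omega) (by omega) o₂ hlen
    obtain ⟨i₀⟩ := id ‹Nonempty ι›
    -- A piece has `ℓ + 1` vertices and `ℓ` colors, and the link adds two vertices and three colors,
    -- so each step costs at most `ℓ + 3` of both.
    have cI₂ : I₂.card ≤ ℓ + 1 :=
      (Finset.card_le_card Finset.subset_union_left).trans ((hp₂ i₀).card_verts.trans_le (by omega))
    have cK₂ : K₂.card ≤ ℓ :=
      (Finset.card_le_card Finset.subset_union_left).trans ((hp₂ i₀).card_colors.trans_le (by omega))
    have cFI' := Finset.card_union_le (FV ∪ I) I₂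
    have cFK' := Finset.card_union_le (FC ∪ K) K₂
    rw [Finset.disjoint_union_right] at hI₂ hK₂
    have hTj := hTF j (Finset.mem_insert_self j J)
    have hSj := hSF j (Finset.mem_insert_self j J)
    have hTU : ∀ i, J.biUnion (fun k => T k i) ⊆ FV := fun i =>
      Finset.biUnion_subset.2 fun k hk => hTF k (hsub hk) i
    have hSU : ∀ i, J.biUnion (fun k => S k i) ⊆ FC := fun i =>
      Finset.biUnion_subset.2 fun k hk => hSF k (hsub hk) i
    have hTd : ∀ i, Disjoint (J.biUnion (fun k => T k i)) (T j i) := fun i => by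
      rw [Finset.disjoint_biUnion_left]
      exact fun k hk => hTT i k (hsub hk) j (Finset.mem_insert_self j J)
        (fun h => hj (h ▸ hk))
    have hSd : ∀ i, Disjoint (J.biUnion (fun k => S k i)) (S j i) := fun i => by
      rw [Finset.disjoint_biUnion_left]
      exact fun k hk => hSS i k (hsub hk) j (Finset.mem_insert_self j J)
        (fun h => hj (h ▸ hk))
    have hV : FV ⊆ FV ∪ I ∪ I₂ := Finset.subset_union_left.trans Finset.subset_union_left
    have hC : FC ⊆ FC ∪ K ∪ K₂ := Finset.subset_union_left.trans Finset.subset_union_left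
    obtain ⟨I₃, K₃, hI₃, hK₃, cI₃, cK₃, hp₃⟩ := hR.exists_link hp hp₂ (fun i => by
        simp only [Finset.disjoint_union_left, Finset.disjoint_union_right]
        exact ⟨⟨⟨hI₂.1.symm.mono_left (hPF i), hI₂.1.symm.mono_left (hTU i)⟩, hI₂.2.symm⟩,
          ⟨hPT i j (Finset.mem_insert_self j J), hTd i⟩, hI.mono_right (hTj i)⟩)
      (fun i => by
        simp only [Finset.disjoint_union_left, Finset.disjoint_union_right]
        exact ⟨⟨⟨hK₂.1.symm.mono_left (hQF i), hK₂.1.symm.mono_left (hSU i)⟩, hK₂.2.symm⟩,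
          ⟨hQS i j (Finset.mem_insert_self j J), hSd i⟩, hK.mono_right (hSj i)⟩)
      (FV ∪ I ∪ I₂) (FC ∪ K ∪ K₂) (by omega) (by omega)
      (fun i => Finset.union_subset_union_left (Finset.union_subset (hPF i) (hTU i)) |>.trans
        Finset.subset_union_left)
      (fun i => Finset.union_subset Finset.subset_union_right ((hTj i).trans hV))
      (fun i => Finset.union_subset_union_left (Finset.union_subset (hQF i) (hSU i)) |>.trans
        Finset.subset_union_left)
      (fun i => Finset.union_subset Finset.subset_union_right ((hSj i).trans hC)) d₁ d₂ d₃
    simp only [Finset.disjoint_union_right] at hI₃ hK₃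
    refine ⟨t₂, I ∪ I₂ ∪ I₃, K ∪ K₂ ∪ K₃, ?_, ?_, ?_, ?_, fun i => (hp₃ i).congr ?_ ?_ ?_⟩
    · simp only [Finset.disjoint_union_left]
      exact ⟨⟨hI, hI₂.1⟩, hI₃.1.1⟩
    · simp only [Finset.disjoint_union_left]
      exact ⟨⟨hK, hK₂.1⟩, hK₃.1.1⟩
    · have := Finset.card_union_le (I ∪ I₂) I₃
      have := Finset.card_union_le I I₂
      omega
    · have := Finset.card_union_le (K ∪ K₂) K₃
      have := Finset.card_union_le K K₂
      omega
    · rw [List.append_assoc, ← ho₂, List.take_append_drop]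
    · rw [Finset.biUnion_insert]
      ac_rfl
    · rw [Finset.biUnion_insert]
      ac_rfl

end ColoredDigraph

/-! ### Local absorbers: hubs, pairs and lists of vertices. -/

namespace ColoredDigraph
variable {V C : Type*} [DecidableEq V] [DecidableEq C]
variable {D : ColoredDigraph V C} {M d : ℕ}

theorem biUnion_const_empty {κ α : Type*} [DecidableEq α] (J : Finset κ) :
    (J.biUnion fun _ => (∅ : Finset α)) = ∅ := by
  ext; simp

/-- Color bookkeeping for a hub: the path uses `f i`, gadget `j` normally absorbs `f j`, and gadget
`i`, whose color is already taken, absorbs the reserve color `f i₀` instead. For `i = i₀` no gadget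
deviates. -/
theorem insert_biUnion_erase_eq {ι α : Type*} [Fintype ι] [DecidableEq ι] [DecidableEq α]
    (f : ι → α) (i₀ i : ι) :
    insert (f i) ((Finset.univ.erase i₀).biUnion fun j => {if i = j then f i₀ else f j}) =
      Finset.univ.image f := by
  ext x
  simp only [Finset.mem_insert, Finset.mem_biUnion, Finset.mem_erase, Finset.mem_univ, and_true,
    Finset.mem_singleton, Finset.mem_image, true_and]
  constructor
  · rintro (rfl | ⟨j, _, rfl⟩)
    · exact ⟨i, rfl⟩
    · by_cases h : i = j
      · exact ⟨i₀, by simp [h]⟩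
      · exact ⟨j, by simp [h]⟩
  · rintro ⟨j, rfl⟩
    by_cases h : i = j
    · exact Or.inl (by rw [h])
    · by_cases h' : j = i₀
      · subst h'
        exact Or.inr ⟨i, h, by simp⟩
      · exact Or.inr ⟨j, h', by simp [h]⟩

/-- Vertex bookkeeping for a list: the hub takes `f i`, pair `i` switches to `g i`, and the other
pairs take `f j`, so all of `f` and exactly the one extra value `g i` are used. -/
theorem insert_biUnion_ite_eq {ι α : Type*} [Fintype ι] [DecidableEq ι] [DecidableEq α]
    (f g : ι → α) (i : ι) :
    insert (f i) (Finset.univ.biUnion fun j => {if i = j then g j else f j}) =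
      insert (g i) (Finset.univ.image f) := by
  ext x
  simp only [Finset.mem_insert, Finset.mem_biUnion, Finset.mem_univ, Finset.mem_singleton,
    Finset.mem_image, true_and]
  constructor
  · rintro (rfl | ⟨j, rfl⟩)
    · exact Or.inr ⟨i, rfl⟩
    · by_cases h : i = j
      · exact Or.inl (by simp [h])
      · exact Or.inr ⟨j, by simp [h]⟩
  · rintro (rfl | ⟨j, rfl⟩)
    · exact Or.inr ⟨i, by simp⟩
    · by_cases h : i = j
      · exact Or.inl (by rw [h])
      · exact Or.inr ⟨j, by simp [h]⟩

/-- The two-edge trails through a hub. -/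
theorem IsHub.rainbowTrail {d₁ d₂ : Dir} {a b : V} {ι : Type*} {w : ι → V}
    (h : IsHub D d₁ d₂ a b w) (i : ι) :
    RainbowTrail D [d₁, d₂] a b {a, w i, b}
      {D.color (arc d₁ a (w i)), D.color (arc d₂ (w i) b)} := by
  have h0 := RainbowTrail.single (arc_mem_verts (h.right_mem i)).2
  have h1 := RainbowTrail.cons (h.right_mem i) (by simpa using arc_ne (h.right_mem i)) (by simp) h0
  exact (RainbowTrail.cons (h.left_mem i) (by simp [arc_ne (h.left_mem i), h.ne])
    (by simpa using h.left_ne_right i i) h1).congr rfl rfl rfl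

/-- Switching between the options of a hub with color gadgets makes the color set independent of
the option. -/
theorem IsHub.exists_absorber (hR : Rich D M d) {d₁ d₂ : Dir} {a b : V} {ι : Type*} [Fintype ι]
    [DecidableEq ι] {w : ι → V} (h : IsHub D d₁ d₂ a b w) {q : ℕ} (hq : Fintype.card ι = q + 1)
    (FV : Finset V) (FC : Finset C) (haF : a ∈ FV) (hbF : b ∈ FV) (hwF : ∀ i, w i ∈ FV)
    (hcF : hubColors D d₁ d₂ a b w ⊆ FC) (hFV : FV.card + 20 * q ≤ M) (hFC : FC.card + 20 * q ≤ M)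
    (o : List Dir) (ho : o.length = 20 * q) :
    ∃ (t : V) (I : Finset V) (K : Finset C), Disjoint I FV ∧ Disjoint K FC ∧
      I.card ≤ 20 * q ∧ K.card ≤ 20 * q ∧
      ∀ i, RainbowTrail D (d₁ :: d₂ :: o) a t ({a, w i, b} ∪ I) (hubColors D d₁ d₂ a b w ∪ K) := by
  have : Nonempty ι := Fintype.card_pos_iff.1 (by omega)
  obtain ⟨i₀⟩ := this
  have : Nonempty ι := ⟨i₀⟩
  have hJ : (Finset.univ.erase i₀).card = q := by
    rw [Finset.card_erase_of_mem (Finset.mem_univ _), Finset.card_univ, hq]; rfl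
  set p : ι → C := fun i => D.color (arc d₁ a (w i)) with hp
  set r : ι → C := fun i => D.color (arc d₂ (w i) b) with hr
  have hpF : ∀ i, p i ∈ FC := fun i => hcF (by simp [hubColors, hp])
  have hrF : ∀ i, r i ∈ FC := fun i => hcF (by simp [hubColors, hr])
  have hpi : Function.Injective p := h.left_injective
  have hri : Function.Injective r := h.right_injective
  have hpr : ∀ i j, p i ≠ r j := h.left_ne_right
  have hsel : ∀ f : ι → C, Function.Injective f → ∀ i j, j ≠ i₀ →
      (if i = j then f i₀ else f j) ≠ f i := by
    intro f hf i j hj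
    split_ifs with hij
    · exact fun e => hj (by rw [← hij, hf e])
    · exact fun e => hij (hf e).symm
  have hsel2 : ∀ f : ι → C, Function.Injective f → ∀ i j j', j ≠ i₀ → j' ≠ i₀ → j ≠ j' →
      (if i = j then f i₀ else f j) ≠ (if i = j' then f i₀ else f j') := by
    intro f hf i j j' hj hj' hne
    split_ifs with h1 h2 h2
    · exact absurd (h1.symm.trans h2) hne
    · exact fun e => hj' (hf e).symm
    · exact fun e => hj (hf e)
    · exact fun e => hne (hf e)
  have hmem : ∀ f : ι → C, (∀ i, f i ∈ FC) → ∀ i j, (if i = j then f i₀ else f j) ∈ FC := by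
    intro f hf i j
    split_ifs <;> exact hf _
  have hav : ∀ f : ι → C, (∀ i, f i ∈ D.colors) → ∀ j, Avail D M 7 (fun _ : ι => ∅)
      (fun i : ι => ({if i = j then f i₀ else f j} : Finset C)) := fun f hf j =>
    (hR.gadget (f i₀) (hf i₀) (f j) (hf j)).comp (fun i => decide (i = j)) (fun _ => rfl)
      (fun i => by simp)
  -- One gadget for `{p i₀, p j}` is added for each `j ≠ i₀`. With its link it has `7 + 3` edges, so
  -- this round uses `10 * q` directions.
  obtain ⟨t₁, I₁, K₁, hI₁, hK₁, cI₁, cK₁, hp₁⟩ := hR.exists_chain (Finset.univ.erase i₀)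
    (fun _ _ => ∅) (fun j i => {if i = j then p i₀ else p j}) le_rfl
    (fun j _ => hav p (fun i => color_mem_colors (h.left_mem i)) j) h.rainbowTrail FV FC
    (fun i => by simp [Finset.insert_subset_iff, haF, hbF, hwF i])
    (fun i => Finset.insert_subset (hpF i) (Finset.singleton_subset_iff.2 (hrF i)))
    (fun _ _ _ => Finset.empty_subset _)
    (fun j _ i => Finset.singleton_subset_iff.2 (hmem p hpF i j))
    (fun _ _ _ => Finset.disjoint_empty_right _)
    (fun i j hj => by
      have hj' := (Finset.mem_erase.1 hj).1
      rw [Finset.disjoint_singleton_right, Finset.mem_insert, Finset.mem_singleton, not_or]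
      refine ⟨hsel p hpi i j hj', ?_⟩
      split_ifs <;> exact hpr _ _)
    (fun _ _ _ _ _ _ => Finset.disjoint_empty_right _)
    (fun i j hj j' hj' hne => Finset.disjoint_singleton.2
      (hsel2 p hpi i j j' (Finset.mem_erase.1 hj).1 (Finset.mem_erase.1 hj').1 hne))
    (by omega) (by omega) (o.take (10 * q)) (by simp [ho, hJ]; omega)
  have c1 := Finset.card_union_le FV I₁
  have c2 := Finset.card_union_le FC K₁
  rw [hJ] at cI₁ cK₁
  have hp₁' : ∀ i, RainbowTrail D ([d₁, d₂] ++ o.take (10 * q)) a t₁ ({a, w i, b} ∪ I₁)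
      (insert (r i) (Finset.univ.image p) ∪ K₁) := fun i => (hp₁ i).congr rfl (by simp [biUnion_const_empty]) (by
    rw [← insert_biUnion_erase_eq p i₀ i, Finset.insert_comm, Finset.insert_union]
    simp [hp, hr])
  -- The same round for the colors `r` on the other side of the hub; the colors `p` are by now
  -- independent of the option.
  obtain ⟨t₂, I₂, K₂, hI₂, hK₂, cI₂, cK₂, hp₂⟩ := hR.exists_chain (Finset.univ.erase i₀)
    (fun _ _ => ∅) (fun j i => {if i = j then r i₀ else r j}) le_rfl
    (fun j _ => hav r (fun i => color_mem_colors (h.right_mem i)) j) hp₁' (FV ∪ I₁) (FC ∪ K₁)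
    (fun i => Finset.union_subset_union_left
      (by simp [Finset.insert_subset_iff, haF, hbF, hwF i]))
    (fun i => Finset.union_subset_union_left (Finset.insert_subset (hrF i)
      (Finset.image_subset_iff.2 fun j _ => hpF j)))
    (fun _ _ _ => Finset.empty_subset _)
    (fun j _ i => Finset.singleton_subset_iff.2 (Finset.mem_union_left _ (hmem r hrF i j)))
    (fun _ _ _ => Finset.disjoint_empty_right _)
    (fun i j hj => by
      have hj' := (Finset.mem_erase.1 hj).1
      rw [Finset.disjoint_singleton_right, Finset.mem_union, Finset.mem_insert, not_or, not_or]
      refine ⟨⟨hsel r hri i j hj', ?_⟩, fun hK => Finset.disjoint_left.1 hK₁ hK (hmem r hrF i j)⟩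
      rw [Finset.mem_image]
      rintro ⟨k, _, hk⟩
      split_ifs at hk <;> exact hpr _ _ hk)
    (fun _ _ _ _ _ _ => Finset.disjoint_empty_right _)
    (fun i j hj j' hj' hne => Finset.disjoint_singleton.2
      (hsel2 r hri i j j' (Finset.mem_erase.1 hj).1 (Finset.mem_erase.1 hj').1 hne))
    (by omega) (by omega) (o.drop (10 * q)) (by simp [ho, hJ]; omega)
  rw [hJ] at cI₂ cK₂
  rw [Finset.disjoint_union_right] at hI₂ hK₂
  refine ⟨t₂, I₁ ∪ I₂, K₁ ∪ K₂, Finset.disjoint_union_left.2 ⟨hI₁, hI₂.1⟩,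
    Finset.disjoint_union_left.2 ⟨hK₁, hK₂.1⟩, ?_, ?_, fun i => (hp₂ i).congr ?_ ?_ ?_⟩
  · have := Finset.card_union_le I₁ I₂
    omega
  · have := Finset.card_union_le K₁ K₂
    omega
  · simp
  · simp [biUnion_const_empty]
  · have := insert_biUnion_erase_eq r i₀ i
    rw [hubColors, ← this]
    simp only [Finset.insert_union, Finset.union_insert]
    congr 1
    ac_rfl

/-- A robustly available piece which contains exactly one of two given vertices. -/
theorem Rich.avail_pair (hR : Rich D M d) {v₁ v₂ : V} (h₁ : v₁ ∈ D.verts) (h₂ : v₂ ∈ D.verts)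
    {M₁ : ℕ} (hM : M₁ + 70 ≤ M) : Avail D M₁ 47 (fun b : Bool => {if b then v₁ else v₂}) (fun _ => ∅) := by
  intro FV₀ FC hFV₀ hFC o ho
  set FV := insert v₁ (insert v₂ FV₀) with hFVdef
  have hFV : FV.card ≤ FV₀.card + 2 := by
    exact (Finset.card_insert_le v₁ (insert v₂ FV₀)).trans
      (Nat.add_le_add_right (Finset.card_insert_le v₂ FV₀) 1)
  have hv₁ : v₁ ∈ FV := by simp [hFVdef]
  have hv₂ : v₂ ∈ FV := by simp [hFVdef]
  -- `47 = 22 + 3 + 22`: two hub absorbers with two options each (`q = 1`) and a link between them.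
  obtain ⟨d₁, d₂, o₁, d₃, d₄, d₅, e₁, e₂, o₂, rfl, ho₁, ho₂⟩ : ∃ d₁ d₂ o₁ d₃ d₄ d₅ e₁ e₂ o₂,
      o = (d₁ :: d₂ :: o₁) ++ d₃ :: d₄ :: d₅ :: e₁ :: e₂ :: o₂ ∧ o₁.length = 20 ∧
        o₂.length = 20 := by
    match o, ho with
    | d₁ :: d₂ :: o', ho =>
      have hl : (o'.drop 20).length = 25 := by simp at ho; simp [ho]
      match hd : o'.drop 20, hl with
      | d₃ :: d₄ :: d₅ :: e₁ :: e₂ :: o₂, hl =>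
        refine ⟨d₁, d₂, o'.take 20, d₃, d₄, d₅, e₁, e₂, o₂, ?_, ?_, by simpa using hl⟩
        · rw [← hd]; simp
        · simp at ho; simp [ho]
  obtain ⟨a₁, b₁, a₂, b₂, z, ha₁, hb₁, ha₂, hb₂, hz, hab, H₁, H₂, hH, hH₁, hH₂⟩ :=
    hR.swap FV FC (by omega) (by omega) v₁ h₁ v₂ h₂ d₁ d₂ e₁ e₂
  set Q₁ := hubColors D d₁ d₂ a₁ b₁ (fun b : Bool => if b then v₁ else z)
  set Q₂ := hubColors D e₁ e₂ a₂ b₂ (fun b : Bool => if b then z else v₂)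
  have cQ₁ : Q₁.card ≤ 4 := (Finset.card_union_le _ _).trans
    (Nat.add_le_add (Finset.card_image_le) (Finset.card_image_le))
  have cQ₂ : Q₂.card ≤ 4 := (Finset.card_union_le _ _).trans
    (Nat.add_le_add (Finset.card_image_le) (Finset.card_image_le))
  set N : Finset V := {a₁, b₁, a₂, b₂, z} with hN
  have cN : N.card ≤ 5 := Finset.card_le_five
  have cF := Finset.card_union_le FV N
  have cQ := Finset.card_union_le Q₁ Q₂
  have cK := Finset.card_union_le FC (Q₁ ∪ Q₂)
  obtain ⟨t₁, I₁, K₁, hI₁, hK₁, cI₁, cK₁, hp₁⟩ := H₁.exists_absorber hR (q := 1) (by simp)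
    (FV ∪ N) (FC ∪ (Q₁ ∪ Q₂)) (by simp [hN]) (by simp [hN])
    (fun i => by cases i <;> simp [hN, hv₁])
    (Finset.subset_union_left.trans Finset.subset_union_right) (by omega) (by omega) o₁ ho₁
  have cF₁ := Finset.card_union_le (FV ∪ N) I₁
  have cC₁ := Finset.card_union_le (FC ∪ (Q₁ ∪ Q₂)) K₁
  obtain ⟨t₂, I₂, K₂, hI₂, hK₂, cI₂, cK₂, hp₂⟩ := H₂.exists_absorber hR (q := 1) (by simp)
    (FV ∪ N ∪ I₁) (FC ∪ (Q₁ ∪ Q₂) ∪ K₁) (by simp [hN]) (by simp [hN])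
    (fun i => by cases i <;> simp [hN, hv₂])
    ((Finset.subset_union_right.trans Finset.subset_union_right).trans Finset.subset_union_left)
    (by omega) (by omega) o₂ ho₂
  have cF₂ := Finset.card_union_le (FV ∪ N ∪ I₁) I₂
  have cC₂ := Finset.card_union_le (FC ∪ (Q₁ ∪ Q₂) ∪ K₁) K₂
  simp only [Finset.disjoint_union_right] at hI₁ hI₂ hK₁ hK₂
  -- Both hubs offer `z`, but for opposite values of `i`, so the two trails are disjoint under each
  -- option.
  obtain ⟨I₃, K₃, hI₃, hK₃, cI₃, cK₃, hp₃⟩ := hR.exists_link hp₁ hp₂ (fun i => by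
      have n1 := arc_ne (H₁.left_mem false)
      have n2 := arc_ne (H₁.right_mem false)
      have n3 := arc_ne (H₂.left_mem true)
      have n4 := arc_ne (H₂.right_mem true)
      have e1 : ∀ x ∈ FV, x ≠ a₁ ∧ x ≠ b₁ ∧ x ≠ a₂ ∧ x ≠ b₂ := fun x hx =>
        ⟨fun h => ha₁ (h ▸ hx), fun h => hb₁ (h ▸ hx), fun h => ha₂ (h ▸ hx),
          fun h => hb₂ (h ▸ hx)⟩
      have hw₁ : ({a₁, if i = true then v₁ else z, b₁} : Finset V) ⊆ FV ∪ N := by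
        cases i <;> simp [hN, Finset.insert_subset_iff, hv₁]
      have hw₂ : ({a₂, if i = true then z else v₂, b₂} : Finset V) ⊆ FV ∪ N := by
        cases i <;> simp [hN, Finset.insert_subset_iff, hv₂]
      have hI₁' : Disjoint I₁ (FV ∪ N) := Finset.disjoint_union_right.2 hI₁
      have hI₂' : Disjoint I₂ (FV ∪ N) := Finset.disjoint_union_right.2 hI₂.1
      rw [Finset.disjoint_union_left, Finset.disjoint_union_right, Finset.disjoint_union_right]
      refine ⟨⟨?_, (hI₂'.mono_right hw₁).symm⟩, hI₁'.mono_right hw₂, hI₂.2.symm⟩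
      simp only [Finset.disjoint_insert_left, Finset.disjoint_singleton_left, Finset.mem_insert,
        Finset.mem_singleton, not_or] at hab ⊢
      have := e1 v₁ hv₁
      have := e1 v₂ hv₂
      have hzv₁ : v₁ ≠ z := fun h => hz (h ▸ hv₁)
      have hzv₂ : v₂ ≠ z := fun h => hz (h ▸ hv₂)
      cases i <;> simp at n1 n2 n3 n4 ⊢ <;> grind)
    (fun i => by
      simp only [Finset.disjoint_union_left, Finset.disjoint_union_right]
      exact ⟨⟨hH, hK₁.2.2⟩, hK₂.1.2.1.symm, hK₂.2.symm⟩)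
    (FV ∪ N ∪ I₁ ∪ I₂) (FC ∪ (Q₁ ∪ Q₂) ∪ K₁ ∪ K₂) (by omega) (by omega)
    (fun i => Finset.union_subset (by cases i <;> simp [hN, Finset.insert_subset_iff, hv₁])
      (Finset.subset_union_right.trans Finset.subset_union_left))
    (fun i => Finset.union_subset (by cases i <;> simp [hN, Finset.insert_subset_iff, hv₂])
      Finset.subset_union_right)
    (fun i => Finset.union_subset
      (((Finset.subset_union_left.trans Finset.subset_union_right).trans
        Finset.subset_union_left).trans Finset.subset_union_left)
      (Finset.subset_union_right.trans Finset.subset_union_left))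
    (fun i => Finset.union_subset
      (((Finset.subset_union_right.trans Finset.subset_union_right).trans
        Finset.subset_union_left).trans Finset.subset_union_left)
      Finset.subset_union_right) d₃ d₄ d₅
  simp only [Finset.disjoint_union_right] at hI₃ hK₃
  have hNF : Disjoint N FV := by
    simp [hN, Finset.disjoint_insert_left, ha₁, hb₁, ha₂, hb₂, hz]
  have hFV₀F : FV₀ ⊆ FV := (Finset.subset_insert _ _).trans (Finset.subset_insert _ _)
  refine ⟨a₁, t₂, N ∪ I₁ ∪ I₂ ∪ I₃, Q₁ ∪ Q₂ ∪ K₁ ∪ K₂ ∪ K₃, ?_, ?_, fun i =>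
    (hp₃ i).congr rfl ?_ ?_⟩
  · simp only [Finset.disjoint_union_left]
    exact ⟨⟨⟨hNF.mono_right hFV₀F, hI₁.1.mono_right hFV₀F⟩, hI₂.1.1.mono_right hFV₀F⟩,
      hI₃.1.1.1.mono_right hFV₀F⟩
  · simp only [Finset.disjoint_union_left]
    exact ⟨⟨⟨⟨hH₁, hH₂⟩, hK₁.1⟩, hK₂.1.1⟩, hK₃.1.1.1⟩
  · cases i <;> ext x <;> simp [hN] <;> grind
  · change Q₁ ∪ K₁ ∪ (Q₂ ∪ K₂) ∪ K₃ = _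
    rw [Finset.union_empty]
    ac_rfl

/-- A robustly available piece which contains exactly one of finitely many given vertices. -/
theorem Rich.avail_local (hR : Rich D M d) {q : ℕ} (hd : d = q + 1) {v : Fin d → V}
    (hv : ∀ i, v i ∈ D.verts) {M₁ : ℕ} (hM : M₁ + 80 * d + 100 ≤ M) :
    Avail D M₁ (70 * q + 52) (fun i => {v i}) (fun _ => ∅) := by
  intro FV₀ FC hFV₀ hFC o ho
  set FV := FV₀ ∪ Finset.univ.image v with hFVdef
  have hFV : FV.card ≤ FV₀.card + d := (Finset.card_union_le _ _).trans
    (Nat.add_le_add_left (Finset.card_image_le.trans_eq (by simp)) _)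
  have hvF : ∀ i, v i ∈ FV := fun i => by simp [hFVdef]
  -- The hub absorber takes `2 + 20 * q` edges and each of the `d = q + 1` linked pairs takes `47 +
  -- 3`, in total `70 * q + 52`.
  obtain ⟨d₁, d₂, o₁, o₂, rfl, ho₁, ho₂⟩ : ∃ d₁ d₂ o₁ o₂, o = (d₁ :: d₂ :: o₁) ++ o₂ ∧
      o₁.length = 20 * q ∧ o₂.length = d * (47 + 3) := by
    match o, ho with
    | d₁ :: d₂ :: o', ho =>
      simp only [List.length_cons] at ho
      exact ⟨d₁, d₂, o'.take (20 * q), o'.drop (20 * q), by simp, by simp; omega, by simp; omega⟩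
  obtain ⟨a, b, w, ha, hb, hw, H, hH⟩ := hR.hub FV FC (by omega) (by omega) d₁ d₂
  set Q := hubColors D d₁ d₂ a b w
  set N : Finset V := {a, b} ∪ Finset.univ.image w with hN
  have cN : N.card ≤ 2 + d := (Finset.card_union_le _ _).trans
    (Nat.add_le_add Finset.card_le_two (Finset.card_image_le.trans_eq (by simp)))
  have cQ : Q.card ≤ d + d := (Finset.card_union_le _ _).trans
    (Nat.add_le_add (Finset.card_image_le.trans_eq (by simp))
      (Finset.card_image_le.trans_eq (by simp)))
  have haN : a ∈ N := by simp [hN]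
  have hbN : b ∈ N := by simp [hN]
  have hwN : ∀ i, w i ∈ N := fun i => by simp [hN]
  have cF := Finset.card_union_le FV N
  have cC := Finset.card_union_le FC Q
  obtain ⟨t₁, I₁, K₁, hI₁, hK₁, cI₁, cK₁, hp₁⟩ := H.exists_absorber hR (q := q) (by simp [hd])
    (FV ∪ N) (FC ∪ Q) (Finset.mem_union_right _ haN) (Finset.mem_union_right _ hbN)
    (fun i => Finset.mem_union_right _ (hwN i)) Finset.subset_union_right (by omega) (by omega)
    o₁ ho₁
  have cF₁ := Finset.card_union_le (FV ∪ N) I₁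
  have cC₁ := Finset.card_union_le (FC ∪ Q) K₁
  have hwv : ∀ i j, w i ≠ v j := fun i j h => hw i (h ▸ hvF j)
  have hmem : ∀ j i, (if i = j then v j else w j) ∈ FV ∪ N := fun j i => by
    split_ifs
    · exact Finset.mem_union_left _ (hvF j)
    · exact Finset.mem_union_right _ (hwN j)
  have : NeZero d := ⟨by omega⟩
  have hPF : ∀ i, {a, w i, b} ∪ I₁ ⊆ FV ∪ N ∪ I₁ := fun i =>
    Finset.union_subset_union_left ((Finset.insert_subset haN (Finset.insert_subset (hwN i)
      (Finset.singleton_subset_iff.2 hbN))).trans Finset.subset_union_right)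
  -- The loss of 70 is the one in `Rich.avail_pair`. The `v j` need not be distinct, since only `v
  -- i` is ever used.
  obtain ⟨t₂, I₂, K₂, hI₂, hK₂, -, -, hp₂⟩ := hR.exists_chain (M₁ := M - 70) Finset.univ
    (fun j i => {if i = j then v j else w j}) (fun _ _ => ∅) (Nat.sub_le _ _)
    (fun j _ => (hR.avail_pair (hv j) (arc_mem_verts (H.right_mem j)).1 (by omega)).comp
      (fun i => decide (i = j)) (fun i => by simp) (fun _ => rfl))
    hp₁ (FV ∪ N ∪ I₁) (FC ∪ Q ∪ K₁) hPF
    (fun i => Finset.union_subset_union_left Finset.subset_union_right)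
    (fun j _ i => Finset.singleton_subset_iff.2 (Finset.mem_union_left _ (hmem j i)))
    (fun _ _ _ => Finset.empty_subset _)
    (fun i j _ => by
      rw [Finset.disjoint_singleton_right, Finset.mem_union, not_or]
      refine ⟨?_, fun h => Finset.disjoint_left.1 hI₁ h (hmem j i)⟩
      simp only [Finset.mem_insert, Finset.mem_singleton, not_or]
      split_ifs with hij
      · exact ⟨fun h => ha (h ▸ hvF j), fun h => hwv i j h.symm, fun h => hb (h ▸ hvF j)⟩
      · exact ⟨(arc_ne (H.left_mem j)).symm, fun h => hij (H.injective h).symm,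
          arc_ne (H.right_mem j)⟩)
    (fun _ _ _ => Finset.disjoint_empty_right _)
    (fun i j _ j' _ hne => by
      rw [Finset.disjoint_singleton]
      split_ifs with h1 h2 h2
      · exact absurd (h1.symm.trans h2) hne
      · exact fun h => hwv j' j h.symm
      · exact hwv j j'
      · exact fun h => hne (H.injective h))
    (fun _ _ _ _ _ _ => Finset.disjoint_empty_right _)
    (by rw [Finset.card_univ, Fintype.card_fin]; omega)
    (by rw [Finset.card_univ, Fintype.card_fin]; omega) o₂ (by simp [ho₂])
  simp only [Finset.disjoint_union_right] at hI₁ hK₁ hI₂ hK₂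
  have hFV₀F : FV₀ ⊆ FV := Finset.subset_union_left
  refine ⟨a, t₂, N ∪ I₁ ∪ I₂, Q ∪ K₁ ∪ K₂, ?_, ?_, fun i => (hp₂ i).congr rfl ?_ ?_⟩
  · simp only [Finset.disjoint_union_left]
    refine ⟨⟨Disjoint.mono_right hFV₀F ?_, hI₁.1.mono_right hFV₀F⟩, hI₂.1.1.mono_right hFV₀F⟩
    simp only [hN, Finset.disjoint_union_left, Finset.disjoint_insert_left,
      Finset.disjoint_singleton_left]
    refine ⟨⟨ha, hb⟩, Finset.disjoint_left.2 fun x hx => ?_⟩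
    obtain ⟨i, -, rfl⟩ := Finset.mem_image.1 hx
    exact hw i
  · simp only [Finset.disjoint_union_left]
    exact ⟨⟨hH, hK₁.1⟩, hK₂.1.1⟩
  · have e := insert_biUnion_ite_eq w v i
    have e1 : ({a, w i, b} : Finset V) = {a, b} ∪ {w i} := by ext; simp; tauto
    rw [Finset.insert_eq, Finset.insert_eq] at e
    calc _ = {a, b} ∪ ({w i} ∪ Finset.univ.biUnion fun j => {if i = j then v j else w j}) ∪
          I₁ ∪ I₂ := by rw [e1]; ac_rfl
      _ = _ := by rw [e, hN]; dsimp only; ac_rfl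
  · change Q ∪ K₁ ∪ _ ∪ K₂ = _
    rw [biUnion_const_empty, Finset.union_empty, Finset.union_empty]

end ColoredDigraph

/-! ### Expanding permutations and the robustly matchable template. -/

theorem exists_perm_image_eq {α : Type*} [Fintype α] [DecidableEq α] {A B : Finset α}
    (h : A.card = B.card) : ∃ π : Equiv.Perm α, A.image π = B := by
  let e : {x // x ∈ A} ≃ {x // x ∈ B} := Finset.equivOfCardEq h
  refine ⟨e.extendSubtype, Finset.eq_of_subset_of_card_le ?_ ?_⟩
  · intro x hx
    obtain ⟨y, hy, rfl⟩ := Finset.mem_image.1 hx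
    exact e.extendSubtype_mem y hy
  · rw [Finset.card_image_of_injective _ e.extendSubtype.injective, h]

/-- This gives the probability that a random permutation maps `A` into `T`. Count pairs `(B, σ)`
with `B.card = A.card` and `σ` mapping `B` into `T`: by symmetry the number of `σ` does not depend
on `B`, while for fixed `σ` the sets `B` are the subsets of that size of the preimage of `T`. -/
theorem card_perm_image_subset_mul_choose {α : Type*} [Fintype α] [DecidableEq α]
    (A T : Finset α) :
    (Finset.univ.filter fun σ : Equiv.Perm α => A.image σ ⊆ T).card *
      (Fintype.card α).choose A.card = T.card.choose A.card * (Fintype.card α).factorial := by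
  have h1 : ∀ B ∈ Finset.powersetCard A.card (Finset.univ : Finset α),
      (Finset.univ.filter fun σ : Equiv.Perm α => B.image σ ⊆ T).card =
        (Finset.univ.filter fun σ : Equiv.Perm α => A.image σ ⊆ T).card := by
    intro B hB
    obtain ⟨π, hπ⟩ := exists_perm_image_eq (Finset.mem_powersetCard.1 hB).2.symm
    refine Finset.card_bij (fun σ _ => σ * π) ?_ ?_ ?_
    · intro σ hσ
      rw [Finset.mem_filter] at hσ ⊢
      refine ⟨Finset.mem_univ _, ?_⟩
      rw [Equiv.Perm.coe_mul, ← Finset.image_image, hπ]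
      exact hσ.2
    · intro σ _ τ _ h
      exact mul_right_cancel h
    · intro σ hσ
      rw [Finset.mem_filter] at hσ
      refine ⟨σ * π⁻¹, ?_, by simp⟩
      rw [Finset.mem_filter]
      refine ⟨Finset.mem_univ _, ?_⟩
      rw [← hπ, Finset.image_image, ← Equiv.Perm.coe_mul]
      simpa using hσ.2
  have h2 : ∀ σ ∈ (Finset.univ : Finset (Equiv.Perm α)),
      ((Finset.powersetCard A.card (Finset.univ : Finset α)).filter
        fun B => B.image σ ⊆ T).card = T.card.choose A.card := by
    intro σ _
    have : (Finset.powersetCard A.card (Finset.univ : Finset α)).filter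
        (fun B => B.image σ ⊆ T) = Finset.powersetCard A.card (T.image σ.symm) := by
      ext B
      simp only [Finset.mem_filter, Finset.mem_powersetCard, Finset.subset_univ, true_and]
      rw [and_comm]
      refine and_congr_left fun _ => ?_
      constructor
      · intro h x hx
        exact Finset.mem_image.2 ⟨σ x, h (Finset.mem_image_of_mem _ hx), by simp⟩
      · intro h
        rw [Finset.image_subset_iff]
        intro x hx
        obtain ⟨y, hy, rfl⟩ := Finset.mem_image.1 (h hx)
        simpa using hy
    rw [this, Finset.card_powersetCard, Finset.card_image_of_injective _ σ.symm.injective]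
  have h3 := Finset.sum_card_bipartiteAbove_eq_sum_card_bipartiteBelow
    (s := Finset.powersetCard A.card (Finset.univ : Finset α))
    (t := (Finset.univ : Finset (Equiv.Perm α))) (fun B σ => B.image σ ⊆ T)
  simp only [Finset.bipartiteAbove, Finset.bipartiteBelow] at h3
  rw [Finset.sum_congr rfl h1, Finset.sum_congr rfl h2, Finset.sum_const, Finset.sum_const,
    Finset.card_powersetCard, Finset.card_univ, Finset.card_univ, Fintype.card_perm,
    smul_eq_mul, smul_eq_mul] at h3
  rw [mul_comm, h3, mul_comm]

/-- Compare falling factorials factor by factor: `2a - k ≤ ρ (N - k)`, because `2a ≤ ρ N` and `ρ ≤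
1`. -/
theorem choose_two_mul_le_pow_mul_choose {N a : ℕ} {ρ : ℝ} (hρ : 2 * (a : ℝ) ≤ ρ * N)
    (hρ1 : ρ ≤ 1) (hρ0 : 0 ≤ ρ) : ((2 * a).choose a : ℝ) ≤ ρ ^ a * N.choose a := by
  have h2 : 2 * a ≤ N := by
    have : (2 * a : ℝ) ≤ N := hρ.trans (mul_le_of_le_one_left (by positivity) hρ1)
    exact_mod_cast this
  have key : ∀ k ≤ a, ((2 * a).descFactorial k : ℝ) ≤ ρ ^ k * N.descFactorial k := by
    intro k hk
    induction k with
    | zero => simp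
    | succ k ih =>
      have h3 : ((2 * a - k : ℕ) : ℝ) ≤ ρ * (N - k : ℕ) := by
        rw [Nat.cast_sub (by omega), Nat.cast_sub (by omega)]
        push_cast
        nlinarith [(Nat.cast_nonneg k : (0:ℝ) ≤ k)]
      rw [Nat.descFactorial_succ, Nat.descFactorial_succ]
      push_cast
      calc _ ≤ (ρ * (N - k : ℕ)) * (ρ ^ k * N.descFactorial k) :=
            mul_le_mul h3 (ih (by omega)) (by positivity) (by positivity)
        _ = _ := by ring
  have h := key a le_rfl
  rw [Nat.descFactorial_eq_factorial_mul_choose, Nat.descFactorial_eq_factorial_mul_choose] at h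
  push_cast at h
  have hf : (0 : ℝ) < a.factorial := by exact_mod_cast a.factorial_pos
  refine le_of_mul_le_mul_left ?_ hf
  linarith

/-- The left side bounds the expected number of bad pairs `(A, T)` with sizes `a` and `2a`. Of the
`d + 3` factors `q`, one reduces `N.choose (2a)` to `N.choose a`, two reduce the resulting square of
`N.choose a` to at most `16 ^ a`, and the other `d` contribute `ρ ^ (a * d)`. -/
theorem union_bound_term_le {N a d : ℕ} {ρ : ℝ} (h : 2 * (a : ℝ) ≤ ρ * N)
    (hρ1 : ρ ≤ 1) (hρ0 : 0 ≤ ρ) (hd : 32 * ρ ^ d ≤ 1) :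
    (N.choose a : ℝ) * N.choose (2 * a) * (((2 * a).choose a : ℝ) / N.choose a) ^ (d + 3) ≤
      (1 / 2) ^ a := by
  have h2 : 2 * a ≤ N := by
    have : (2 * a : ℝ) ≤ N := h.trans (mul_le_of_le_one_left (by positivity) hρ1)
    exact_mod_cast this
  have hN : (0 : ℝ) < N.choose a := by exact_mod_cast Nat.choose_pos (by omega)
  set q : ℝ := ((2 * a).choose a : ℝ) / N.choose a with hq
  have hq0 : 0 ≤ q := by positivity
  have hqρ : q ≤ ρ ^ a := by
    rw [hq, div_le_iff₀ hN]
    exact choose_two_mul_le_pow_mul_choose h hρ1 hρ0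
  have hNq : (N.choose a : ℝ) * q = (2 * a).choose a := by rw [hq]; field_simp
  have h4 : ((2 * a).choose a : ℝ) ≤ 4 ^ a := by
    have := Nat.choose_le_two_pow (2 * a) a
    rw [pow_mul] at this
    exact_mod_cast this
  have h5 : (N.choose (2 * a) : ℝ) * q ≤ N.choose a := by
    have e : (N.choose (2 * a) : ℝ) * (2 * a).choose a = N.choose a * (N - a).choose a := by
      have := Nat.choose_mul (n := N) (show a ≤ 2 * a by omega)
      rw [show 2 * a - a = a by omega] at this
      exact_mod_cast this
    rw [hq, ← mul_div_assoc, e, div_le_iff₀ hN, mul_comm]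
    refine mul_le_mul_of_nonneg_right ?_ hN.le
    exact_mod_cast Nat.choose_le_choose a (Nat.sub_le N a)
  calc (N.choose a : ℝ) * N.choose (2 * a) * q ^ (d + 3)
      = (N.choose (2 * a) * q) * ((N.choose a * q) * q) * q ^ d := by ring
    _ ≤ N.choose a * ((N.choose a * q) * q) * q ^ d := by gcongr
    _ = (N.choose a * q) ^ 2 * q ^ d := by ring
    _ ≤ (4 ^ a) ^ 2 * (ρ ^ a) ^ d := by rw [hNq]; gcongr
    _ = (16 * ρ ^ d) ^ a := by
      rw [mul_pow, ← pow_mul, ← pow_mul, ← pow_mul, mul_comm a 2, pow_mul, mul_comm a d]; norm_num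
    _ ≤ _ := by
      gcongr
      linarith

/-- There are boundedly many permutations whose union at least doubles the size of all small
sets. -/
theorem exists_expanding_perms (N d : ℕ) {ρ : ℝ} (hρ1 : ρ ≤ 1) (hρ0 : 0 ≤ ρ)
    (hd : 32 * ρ ^ d ≤ 1) :
    ∃ σ : Fin (d + 3) → Equiv.Perm (Fin N), ∀ A : Finset (Fin N), 2 * (A.card : ℝ) ≤ ρ * N →
      2 * A.card ≤ (Finset.univ.biUnion fun j => A.image (σ j)).card := by
  by_contra! hcon
  set 𝒜 : Finset (Finset (Fin N)) :=
    Finset.univ.filter fun A => 2 * (A.card : ℝ) ≤ ρ * N ∧ A.Nonempty with h𝒜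
  -- Union bound: if every tuple fails, then every tuple has a nonempty `A` all of whose images lie
  -- in one `T` of size `2 * A.card`.
  have hcover : (Finset.univ : Finset (Fin (d + 3) → Equiv.Perm (Fin N))) ⊆
      𝒜.biUnion fun A => (Finset.powersetCard (2 * A.card) Finset.univ).biUnion fun T =>
        Fintype.piFinset fun _ => Finset.univ.filter fun σ : Equiv.Perm (Fin N) =>
          A.image σ ⊆ T := by
    intro σ _
    obtain ⟨A, hA, hlt⟩ := hcon σ
    have h2 : 2 * A.card ≤ N := by
      have : (2 * A.card : ℝ) ≤ N := hA.trans (mul_le_of_le_one_left (by positivity) hρ1)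
      exact_mod_cast this
    obtain ⟨T, hT, hTc⟩ := Finset.exists_superset_card_eq hlt.le (by simpa using h2)
    simp only [Finset.mem_biUnion, Fintype.mem_piFinset, Finset.mem_filter, Finset.mem_univ,
      true_and, Finset.mem_powersetCard, Finset.subset_univ]
    refine ⟨A, ?_, T, hTc, fun j => (Finset.subset_biUnion_of_mem (fun j => A.image (σ j))
      (Finset.mem_univ j)).trans hT⟩
    simp only [h𝒜, Finset.mem_filter, Finset.mem_univ, true_and]
    refine ⟨hA, Finset.card_pos.1 ?_⟩
    omega
  have h1 := (Finset.card_le_card hcover).trans Finset.card_biUnion_le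
  have h2 : ∀ A ∈ 𝒜, ((((Finset.powersetCard (2 * A.card) Finset.univ).biUnion fun T =>
        Fintype.piFinset fun _ : Fin (d + 3) => Finset.univ.filter fun σ : Equiv.Perm (Fin N) =>
          A.image σ ⊆ T).card : ℕ) : ℝ) ≤
      (1 / 2) ^ A.card / N.choose A.card * (N.factorial : ℝ) ^ (d + 3) := by
    intro A hA
    have hA' := (Finset.mem_filter.1 hA).2.1
    have hN : (0 : ℝ) < N.choose A.card := by
      exact_mod_cast Nat.choose_pos (by simpa using Finset.card_le_univ A)
    have hb : ((((Finset.powersetCard (2 * A.card) Finset.univ).biUnion fun T =>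
        Fintype.piFinset fun _ : Fin (d + 3) => Finset.univ.filter fun σ : Equiv.Perm (Fin N) =>
          A.image σ ⊆ T).card : ℕ) : ℝ) ≤
        N.choose (2 * A.card) * ((((2 * A.card).choose A.card : ℝ) / N.choose A.card) *
          N.factorial) ^ (d + 3) := by
      have hle := Finset.card_biUnion_le (s := Finset.powersetCard (2 * A.card) Finset.univ)
        (t := fun T => Fintype.piFinset fun _ : Fin (d + 3) =>
          Finset.univ.filter fun σ : Equiv.Perm (Fin N) => A.image σ ⊆ T)
      refine (Nat.cast_le.2 hle).trans ?_
      rw [Nat.cast_sum]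
      refine (Finset.sum_le_card_nsmul _ _ ((((2 * A.card).choose A.card : ℝ) / N.choose A.card *
          N.factorial) ^ (d + 3)) ?_).trans_eq ?_
      · intro T hT
        have hc := card_perm_image_subset_mul_choose A T
        rw [(Finset.mem_powersetCard.1 hT).2, Fintype.card_fin] at hc
        rw [Fintype.card_piFinset_const, Nat.cast_pow]
        refine pow_le_pow_left₀ (by positivity) (le_of_eq ?_) _
        rw [div_mul_eq_mul_div, eq_div_iff hN.ne']
        exact_mod_cast hc
      · rw [Finset.card_powersetCard, Finset.card_univ, Fintype.card_fin, nsmul_eq_mul]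
    refine hb.trans ?_
    rw [mul_pow, ← mul_assoc]
    refine mul_le_mul_of_nonneg_right ?_ (by positivity)
    rw [le_div_iff₀ hN]
    have := union_bound_term_le hA' hρ1 hρ0 hd
    linarith
  have h3 : ((N.factorial : ℝ)) ^ (d + 3) ≤ (∑ A ∈ 𝒜, (1 / 2) ^ A.card / (N.choose A.card : ℝ)) *
      (N.factorial : ℝ) ^ (d + 3) := by
    rw [Finset.sum_mul]
    refine le_trans ?_ (Finset.sum_le_sum h2)
    rw [← Nat.cast_sum]
    refine le_trans (le_of_eq ?_) (Nat.cast_le.2 h1)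
    simp [Fintype.card_perm]
  -- There are at most `N.choose a` sets of size `a`, so the sum is at most the geometric sum of `2
  -- ^ (-a)` over `1 ≤ a ≤ N`.
  have h4 : (∑ A ∈ 𝒜, (1 / 2) ^ A.card / (N.choose A.card : ℝ)) < 1 := by
    calc (∑ A ∈ 𝒜, (1 / 2) ^ A.card / (N.choose A.card : ℝ))
        = ∑ a ∈ Finset.Ico 1 (N + 1), ∑ A ∈ 𝒜 with A.card = a,
            (1 / 2) ^ A.card / (N.choose A.card : ℝ) := by
          rw [Finset.sum_fiberwise_of_maps_to]
          intro A hA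
          have := (Finset.mem_filter.1 hA).2.2.card_pos
          have := Finset.card_le_univ A
          rw [Fintype.card_fin] at this
          rw [Finset.mem_Ico]
          omega
      _ ≤ ∑ a ∈ Finset.Ico 1 (N + 1), (1 / 2 : ℝ) ^ a := by
          refine Finset.sum_le_sum fun a ha => ?_
          rw [Finset.mem_Ico] at ha
          have hN : (0 : ℝ) < N.choose a := by exact_mod_cast Nat.choose_pos (by omega)
          refine (Finset.sum_le_card_nsmul _ _ ((1 / 2 : ℝ) ^ a / (N.choose a : ℝ)) ?_).trans ?_
          · intro A hA
            rw [(Finset.mem_filter.1 hA).2]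
          · rw [nsmul_eq_mul, mul_div_assoc', div_le_iff₀ hN, mul_comm]
            refine mul_le_mul_of_nonneg_left ?_ (by positivity)
            have : (𝒜.filter fun A => A.card = a) ⊆ Finset.powersetCard a Finset.univ := by
              intro A hA
              simp [(Finset.mem_filter.1 hA).2]
            have := Finset.card_le_card this
            rw [Finset.card_powersetCard, Finset.card_univ, Fintype.card_fin] at this
            exact_mod_cast this
      _ = 1 - (1 / 2) ^ N := by
          rw [Finset.sum_Ico_eq_sum_range]
          simp only [Nat.add_sub_cancel, pow_add, ← Finset.mul_sum]
          rw [geom_sum_eq (by norm_num)]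
          ring
      _ < 1 := by
          have : (0 : ℝ) < (1 / 2) ^ N := by positivity
          linarith
  have hf : (0 : ℝ) < (N.factorial : ℝ) ^ (d + 3) := by
    have := N.factorial_pos
    positivity
  nlinarith

theorem exists_fin_range_eq {α : Type*} (s : Finset α) (hs : s.Nonempty) {k : ℕ}
    (hk : s.card ≤ k) : ∃ f : Fin k → α, ∀ x, x ∈ s ↔ ∃ i, f i = x := by
  obtain ⟨e⟩ : Nonempty (s ↪ Fin k) :=
    Function.Embedding.nonempty_of_card_le (by simpa using hk)
  have : Nonempty s := hs.to_subtype
  refine ⟨fun i => (Function.invFun e i : s), fun x => ⟨fun hx => ⟨e ⟨x, hx⟩, ?_⟩, ?_⟩⟩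
  · exact congrArg Subtype.val (Function.leftInverse_invFun e.injective ⟨x, hx⟩)
  · rintro ⟨i, rfl⟩
    exact Subtype.coe_prop _

/-- If `G` is too large for the expansion hypothesis, a subset of size `h` already has enough
neighbors. -/
theorem le_card_biUnion_perms {N k h : ℕ} {κ : Type*} [Fintype κ] {σ : κ → Equiv.Perm (Fin N)}
    (hσ : ∀ A : Finset (Fin N), A.card ≤ h →
      2 * A.card ≤ (Finset.univ.biUnion fun j => A.image (σ j)).card)
    {G : Finset (Fin N)} (hG : k ≤ 2 * G.card) (hk : k ≤ 2 * h) :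
    k ≤ (Finset.univ.biUnion fun j => G.image (σ j)).card := by
  by_cases hGh : G.card ≤ h
  · exact hG.trans (hσ G hGh)
  · obtain ⟨G', hG', hc⟩ := Finset.exists_subset_card_eq (not_le.1 hGh).le
    refine hk.trans ((hc ▸ hσ G' hc.le).trans (Finset.card_le_card ?_))
    exact Finset.biUnion_mono fun j _ => Finset.image_subset_image hG'

/-- A bipartite graph with `3 m` left vertices of bounded degree and right vertices in two parts
`Y` and `X` of size `2 m`, such that for each `m`-subset `U` of `X` there is a perfect matching
between the left vertices and `Y ∪ U`. -/
theorem exists_robustly_matchable {m : ℕ} (hm : 40 ≤ m) :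
    ∃ nbr : Fin (3 * m) → Fin 35 → Fin (2 * m) ⊕ Fin (2 * m),
      ∀ U : Finset (Fin (2 * m)), U.card = m → ∃ θ : Fin (3 * m) → Fin 35,
        Function.Injective (fun l => nbr l (θ l)) ∧
        Finset.univ.image (fun l => nbr l (θ l)) =
          Finset.univ.image Sum.inl ∪ U.image Sum.inr := by
  -- `σ` has 8 permutations and makes sets of right vertices expand; `τ` has 19 and makes sets of
  -- left vertices expand into `Y`. The maps `g` and `f` below are at most two-to-one, so doubling
  -- still gives expansion factor one, and left degrees are at most `8 * 2 + 19 = 35`.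
  obtain ⟨σ, hσ⟩ := exists_expanding_perms (3 * m) 5 (ρ := 1 / 2) (by norm_num) (by norm_num)
    (by norm_num)
  obtain ⟨τ, hτ⟩ := exists_expanding_perms (2 * m) 16 (ρ := 4 / 5) (by norm_num) (by norm_num)
    (by norm_num)
  replace hσ : ∀ A : Finset (Fin (3 * m)), A.card ≤ 3 * m / 4 →
      2 * A.card ≤ (Finset.univ.biUnion fun j => A.image (σ j)).card := fun A hA => hσ A (by
    have : 4 * A.card ≤ 3 * m := by omega
    have : (4 * A.card : ℝ) ≤ 3 * m := by exact_mod_cast this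
    push_cast
    linarith)
  replace hτ : ∀ A : Finset (Fin (2 * m)), A.card ≤ 4 * m / 5 →
      2 * A.card ≤ (Finset.univ.biUnion fun j => A.image (τ j)).card := fun A hA => hτ A (by
    have : 5 * A.card ≤ 4 * m := by omega
    have : (5 * A.card : ℝ) ≤ 4 * m := by exact_mod_cast this
    push_cast
    linarith)
  let g : Fin (2 * m) ⊕ Fin (2 * m) → Fin (3 * m) :=
    Sum.elim (Fin.castLE (by omega)) (Fin.castLE (by omega))
  let f : Fin (3 * m) → Fin (2 * m) := fun l => ⟨l % (2 * m), Nat.mod_lt _ (by omega)⟩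
  have hg : ∀ x, (Finset.univ.filter fun r => g r = x).card ≤ 2 := by
    intro x
    have hsub : (Finset.univ.filter fun r => g r = x) ⊆
        (Finset.univ.filter fun y : Fin (2 * m) => g (Sum.inl y) = x).image Sum.inl ∪
        (Finset.univ.filter fun y : Fin (2 * m) => g (Sum.inr y) = x).image Sum.inr := by
      rintro (y | y) hy <;> simpa using hy
    refine (Finset.card_le_card hsub).trans ((Finset.card_union_le _ _).trans
      (Nat.add_le_add (b := 1) (d := 1) (Finset.card_image_le.trans ?_) (Finset.card_image_le.trans ?_)))
    all_goals
      rw [Finset.card_le_one]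
      intro a ha b hb
      rw [Finset.mem_filter] at ha hb
      exact Fin.castLE_injective (show 2 * m ≤ 3 * m by omega) (ha.2.trans hb.2.symm)
  have hf : ∀ x, (Finset.univ.filter fun l => f l = x).card ≤ 2 := by
    intro x
    rw [← Finset.card_image_of_injective _ Fin.val_injective]
    refine le_trans (Finset.card_le_card (t := {x.val, x.val + 2 * m}) ?_) Finset.card_le_two
    intro y hy
    obtain ⟨l, hl, rfl⟩ := Finset.mem_image.1 hy
    have hl' : l.val % (2 * m) = x.val := congrArg Fin.val (Finset.mem_filter.1 hl).2
    have h1 := Nat.div_add_mod l.val (2 * m)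
    have h2 : l.val / (2 * m) < 2 := Nat.div_lt_of_lt_mul (by omega)
    rw [Finset.mem_insert, Finset.mem_singleton]
    interval_cases l.val / (2 * m) <;> omega
  let t : Fin (3 * m) → Finset (Fin (2 * m) ⊕ Fin (2 * m)) := fun l =>
    (Finset.univ.biUnion fun j => Finset.univ.filter fun r => g r = (σ j).symm l) ∪
      Finset.univ.image fun j => Sum.inl (τ j (f l))
  have ht1 : ∀ l r j, σ j (g r) = l → r ∈ t l := by
    rintro l r j rfl
    refine Finset.mem_union_left _ (Finset.mem_biUnion.2 ⟨j, Finset.mem_univ _, ?_⟩)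
    simp
  have ht2 : ∀ l j, Sum.inl (τ j (f l)) ∈ t l := fun l j =>
    Finset.mem_union_right _ (Finset.mem_image_of_mem _ (Finset.mem_univ j))
  have htc : ∀ l, (t l).card ≤ 35 := by
    intro l
    refine (Finset.card_union_le _ _).trans
      (Nat.add_le_add (b := 16) (d := 19) (Finset.card_biUnion_le.trans ?_)
        (Finset.card_image_le.trans_eq (by simp)))
    refine (Finset.sum_le_card_nsmul _ _ 2 fun j _ => hg _).trans ?_
    simp
  choose nbr hnbr using fun l => exists_fin_range_eq (t l) ⟨_, ht2 l 0⟩ (htc l)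
  refine ⟨nbr, fun U hU => ?_⟩
  set W : Finset (Fin (2 * m) ⊕ Fin (2 * m)) :=
    Finset.univ.image Sum.inl ∪ U.image Sum.inr with hW
  have hWc : W.card = 3 * m := by
    rw [hW, Finset.card_union_of_disjoint, Finset.card_image_of_injective _ Sum.inl_injective,
      Finset.card_image_of_injective _ Sum.inr_injective, hU]
    · simp; ring
    · rw [Finset.disjoint_left]
      simp
  have hall : ∀ B : Finset (Fin (3 * m)), B.card ≤ (B.biUnion fun l => t l ∩ W).card := by
    intro B
    -- Hall's condition: up to size about `8m/5`, `τ` alone supplies enough neighbors in `Y`. For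
    -- larger `B`, a violation leaves `3m - B.card + 1` vertices of `W` with no neighbor in `B`;
    -- this is below `3m/2`, so `σ` gives them at least as many neighbors, all outside `B`, which is
    -- too many. The gap between `7m/5` and `3m/2` absorbs the rounding since `40 ≤ m`.
    by_cases hB : B.card ≤ 2 * (4 * m / 5)
    · have h1 : B.card ≤ 2 * (B.image f).card :=
        Finset.card_le_mul_card_image B 2 fun x _ => (Finset.card_le_card
          (Finset.filter_subset_filter _ (Finset.subset_univ B))).trans (hf x)
      refine (le_card_biUnion_perms hτ h1 hB).trans ?_
      rw [← Finset.card_image_of_injective _ (Sum.inl_injective (β := Fin (2 * m)))]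
      refine Finset.card_le_card fun r hr => ?_
      simp only [Finset.mem_image, Finset.mem_biUnion, Finset.mem_univ, true_and] at hr
      obtain ⟨_, ⟨j, _, ⟨l, hl, rfl⟩, rfl⟩, rfl⟩ := hr
      exact Finset.mem_biUnion.2 ⟨l, hl, Finset.mem_inter.2 ⟨ht2 l j, by simp [hW]⟩⟩
    · by_contra! hlt
      have hB3 : B.card ≤ 3 * m := by simpa using Finset.card_le_univ B
      have hsd := Finset.le_card_sdiff (B.biUnion fun l => t l ∩ W) W
      obtain ⟨A, hA, hAc⟩ := Finset.exists_subset_card_eq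
        (show 3 * m - B.card + 1 ≤ (W \ B.biUnion fun l => t l ∩ W).card by omega)
      have h1 : A.card ≤ 2 * (A.image g).card :=
        Finset.card_le_mul_card_image A 2 fun x _ => (Finset.card_le_card
          (Finset.filter_subset_filter _ (Finset.subset_univ A))).trans (hg x)
      have h2 := le_card_biUnion_perms hσ h1 (by omega)
      have h3 : Disjoint (Finset.univ.biUnion fun j => (A.image g).image (σ j)) B := by
        rw [Finset.disjoint_left]
        intro l hl hlB
        simp only [Finset.mem_image, Finset.mem_biUnion, Finset.mem_univ, true_and] at hl
        obtain ⟨j, _, ⟨r, hr, rfl⟩, hl⟩ := hl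
        have hr' := Finset.mem_sdiff.1 (hA hr)
        exact hr'.2 (Finset.mem_biUnion.2 ⟨l, hlB, Finset.mem_inter.2 ⟨ht1 l r j hl, hr'.1⟩⟩)
      have h4 := Finset.card_le_univ ((Finset.univ.biUnion fun j => (A.image g).image (σ j)) ∪ B)
      rw [Finset.card_union_of_disjoint h3, Fintype.card_fin] at h4
      omega
  obtain ⟨φ, hφ, hφt⟩ := (Finset.all_card_le_biUnion_card_iff_exists_injective _).1 hall
  choose θ hθ using fun l => (hnbr l (φ l)).1 (Finset.mem_inter.1 (hφt l)).1
  have hθ' : (fun l => nbr l (θ l)) = φ := funext hθ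
  refine ⟨θ, hθ' ▸ hφ, hθ' ▸ Finset.eq_of_subset_of_card_le ?_ ?_⟩
  · exact Finset.image_subset_iff.2 fun l _ => (Finset.mem_inter.1 (hφt l)).2
  · rw [Finset.card_image_of_injective _ hφ, hWc]
    simp

/-! ### Passing between trails, paths and absorbers. -/

namespace ColoredDigraph
variable {V C : Type*} [DecidableEq V] [DecidableEq C]
variable {D : ColoredDigraph V C} {M d : ℕ}

theorem image_univ_fin_succ {α : Type*} [DecidableEq α] {k : ℕ} (f : Fin (k + 1) → α) :
    Finset.univ.image f = insert (f 0) (Finset.univ.image fun i : Fin k => f i.succ) := by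
  ext x
  simp [Fin.exists_fin_succ, eq_comm]

theorem IsRainbowPath.rainbowTrail {k : ℕ} {o : Fin k → Dir} {s t : V} {p : Fin (k + 1) → V}
    (h : D.IsRainbowPath o s t p) :
    RainbowTrail D (List.ofFn o) s t (pathVerts p) (D.pathColors o p) := by
  induction k generalizing s with
  | zero =>
    have h0 := h.start
    have h1 := h.finish
    have : t = s := h1.symm.trans h0
    subst this
    refine (RainbowTrail.single (v := t) (h0 ▸ h.mem_verts 0)).congr rfl ?_ ?_
    · simp [pathVerts, h0]
    · simp [pathColors]
  | succ k ih =>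
    have ht : D.IsRainbowPath (fun i : Fin k => o i.succ) (p 1) t (fun i => p i.succ) :=
      { mem_verts := fun i => h.mem_verts _
        injective := h.injective.comp (Fin.succ_injective _)
        mem_edges := fun i => h.mem_edges i.succ
        rainbow := fun i j hij => Fin.succ_injective _ (h.rainbow hij)
        start := rfl
        finish := h.finish }
    have he := h.mem_edges 0
    rw [List.ofFn_succ]
    rw [← h.start, pathVerts, pathColors, image_univ_fin_succ p,
      image_univ_fin_succ fun i => D.color (arc (o i) (p i.castSucc) (p i.succ))]
    refine RainbowTrail.cons he ?_ ?_ (ih ht)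
    · simp only [Finset.mem_image, Finset.mem_univ, true_and, not_exists]
      exact fun i hi => Fin.succ_ne_zero _ (h.injective hi)
    · simp only [Finset.mem_image, Finset.mem_univ, true_and, not_exists]
      exact fun i hi => Fin.succ_ne_zero i (h.rainbow hi)

theorem RainbowTrail.exists_isRainbowPath {l : List Dir} {s t : V} {P : Finset V} {Q : Finset C}
    (h : RainbowTrail D l s t P Q) {k : ℕ} (o : Fin k → Dir) (hl : l = List.ofFn o) :
    ∃ p : Fin (k + 1) → V, D.IsRainbowPath o s t p ∧ pathVerts p = P ∧ D.pathColors o p = Q := by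
  induction h generalizing k with
  | @single v hv =>
    obtain rfl : k = 0 := by simpa using (congrArg List.length hl).symm
    refine ⟨fun _ => v, ⟨fun _ => hv, fun i j _ => Subsingleton.elim (α := Fin 1) i j, fun i => i.elim0,
      fun i => i.elim0, rfl, rfl⟩, ?_, ?_⟩
    · simp [pathVerts]
    · simp [pathColors]
  | @cons d l u v t P Q he hu hc h ih =>
    obtain ⟨k, rfl⟩ : ∃ k', k = k' + 1 := ⟨l.length, by simpa using (congrArg List.length hl).symm⟩
    rw [List.ofFn_succ, List.cons.injEq] at hl
    obtain ⟨rfl, hl⟩ := hl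
    obtain ⟨p, hp, rfl, rfl⟩ := ih (fun i => o i.succ) hl
    have hcol : (fun i : Fin (k + 1) => D.color (arc (o i)
        ((Fin.cons u p : Fin (k + 2) → V) i.castSucc) ((Fin.cons u p : Fin (k + 2) → V) i.succ))) =
        Fin.cons (D.color (arc (o 0) u v))
          (fun i : Fin k => D.color (arc (o i.succ) (p i.castSucc) (p i.succ))) := by
      funext i
      refine Fin.cases ?_ (fun i => ?_) i
      · simp [hp.start]
      · rw [← Fin.succ_castSucc]
        simp
    refine ⟨Fin.cons u p, ⟨?_, ?_, ?_, ?_, rfl, ?_⟩, ?_, ?_⟩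
    · intro i
      refine Fin.cases ?_ (fun i => ?_) i
      · simpa using (arc_mem_verts he).1
      · simpa using hp.mem_verts i
    · rw [Fin.cons_injective_iff]
      refine ⟨?_, hp.injective⟩
      simpa [pathVerts] using hu
    · intro i
      refine Fin.cases ?_ (fun i => ?_) i
      · simpa [hp.start] using he
      · rw [← Fin.succ_castSucc]
        simpa using hp.mem_edges i
    · rw [hcol, Fin.cons_injective_iff]
      refine ⟨?_, hp.rainbow⟩
      simpa [pathColors] using hc
    · rw [← Fin.succ_last]
      simpa using hp.finish
    · rw [pathVerts, image_univ_fin_succ]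
      rfl
    · rw [pathColors, hcol, image_univ_fin_succ]
      rfl

theorem RainbowTrail.of_subdigraph {A : ColoredDigraph V C} (hA : A.IsSubdigraph D)
    {o : List Dir} {s t : V} {P : Finset V} {Q : Finset C} (h : RainbowTrail A o s t P Q) :
    RainbowTrail D o s t P Q := by
  induction h with
  | single hv => exact .single (hA.1 hv)
  | cons he hu hc h ih =>
    rw [hA.2.2 _ he] at hc ⊢
    exact .cons (hA.2.1 he) hu hc ih

/-- The subdigraph of all edges between vertices in `P` with colors in `Q`. -/
def restrict (D : ColoredDigraph V C) (P : Finset V) (Q : Finset C) : ColoredDigraph V C where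
  verts := P
  edges := D.edges.filter fun e => e.1 ∈ P ∧ e.2 ∈ P ∧ D.color e ∈ Q
  color := D.color
  mem_verts _ he := ⟨(Finset.mem_filter.1 he).2.1, (Finset.mem_filter.1 he).2.2.1⟩
  loopless _ he := D.loopless _ (Finset.mem_filter.1 he).1

theorem restrict_isSubdigraph {P : Finset V} {Q : Finset C} (hP : P ⊆ D.verts) :
    (D.restrict P Q).IsSubdigraph D :=
  ⟨hP, Finset.filter_subset _ _, fun _ _ => rfl⟩

theorem colors_restrict_subset (P : Finset V) (Q : Finset C) : (D.restrict P Q).colors ⊆ Q :=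
  Finset.image_subset_iff.2 fun _ he => (Finset.mem_filter.1 he).2.2.2

theorem RainbowTrail.restrict {o : List Dir} {s t : V} {P : Finset V} {Q : Finset C}
    (h : RainbowTrail D o s t P Q) {P' : Finset V} {Q' : Finset C} (hP : P ⊆ P') (hQ : Q ⊆ Q') :
    RainbowTrail (D.restrict P' Q') o s t P Q := by
  induction h with
  | single hv => exact .single (hP (Finset.mem_singleton_self _))
  | @cons d o u v t P Q he hu hc h ih =>
    rw [Finset.insert_subset_iff] at hP hQ
    refine .cons (D := D.restrict P' Q') ?_ hu hc (ih hP.2 hQ.2)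
    refine Finset.mem_filter.2 ⟨he, ?_, ?_, hQ.1⟩
    · cases d
      · exact hP.1
      · exact hP.2 h.start_mem
    · cases d
      · exact hP.2 h.start_mem
      · exact hP.1

/-- Padding that brings the absorber to the prescribed length. Only the first edge of each link is
kept, so the far end of the link is irrelevant and is taken to be `s`. -/
theorem Rich.exists_trail (hR : Rich D M d) (o : List Dir) {s : V} (hs : s ∈ D.verts)
    (FV : Finset V) (FC : Finset C) (hsF : s ∉ FV) (hFV : FV.card + o.length ≤ M)
    (hFC : FC.card + o.length ≤ M) :
    ∃ (t : V) (P : Finset V) (Q : Finset C), RainbowTrail D o s t P Q ∧ Disjoint P FV ∧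
      Disjoint Q FC := by
  induction o generalizing s FV FC with
  | nil => exact ⟨s, _, _, .single hs, by simpa using hsF, by simp⟩
  | cons d₁ o ih =>
    rw [List.length_cons] at hFV hFC
    have hc := Finset.card_insert_le s FV
    obtain ⟨x, y, hx, -, hex, -, -, hcx, -⟩ :=
      hR.link (insert s FV) FC (by omega) (by omega) s hs s hs d₁ d₁ d₁
    have hc' := Finset.card_insert_le (D.color (arc d₁ s x)) FC
    obtain ⟨t, P, Q, h, hP, hQ⟩ := ih (arc_mem_verts hex).2 (insert s FV)
      (insert (D.color (arc d₁ s x)) FC) hx (by omega) (by omega)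
    rw [Finset.disjoint_insert_right] at hP hQ
    refine ⟨t, _, _, .cons hex hP.1 hQ.1 h, ?_, ?_⟩
    · rw [Finset.disjoint_insert_left]
      exact ⟨hsF, hP.2⟩
    · rw [Finset.disjoint_insert_left]
      exact ⟨hcx, hQ.2⟩

/-- Every vertex of `X` extends to an `m`-subset; for `m = 0` the union would be empty. -/
theorem famVerts_vertexSubsets {X : Finset V} {m : ℕ} (hm : 0 < m) (hX : m ≤ X.card) :
    famVerts (vertexSubsets C X m) = X := by
  ext x
  simp only [famVerts, vertexSubsets, Finset.mem_biUnion, Finset.mem_image,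
    Finset.mem_powersetCard]
  constructor
  · rintro ⟨_, ⟨U, ⟨hU, _⟩, rfl⟩, hx⟩
    exact hU hx
  · intro hx
    obtain ⟨U, h1, h2, h3⟩ := Finset.exists_subsuperset_card_eq
      (Finset.singleton_subset_iff.2 hx) hm hX
    exact ⟨_, ⟨U, ⟨h2, h3⟩, rfl⟩, h1 (Finset.mem_singleton_self x)⟩

theorem famColors_vertexSubsets {X : Finset V} {m : ℕ} :
    famColors (vertexSubsets C X m) = ∅ := by
  ext x
  simp only [famColors, vertexSubsets, Finset.mem_biUnion, Finset.mem_image,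
    Finset.notMem_empty, iff_false]
  rintro ⟨_, ⟨U, _, rfl⟩, hx⟩
  exact Finset.notMem_empty x hx

/-- Trails with vertex sets `I ∪ U` and a fixed color set for all `m`-subsets `U` of `X` form an
absorber. -/
theorem hasAbsorber_of_trails {X V' I : Finset V} {C' K : Finset C} {m k : ℕ} (hm : 0 < m)
    (hk : 0 < k) (hmX : m ≤ X.card) (hX : X ⊆ D.verts) (hI : I ⊆ D.verts) (hIX : Disjoint I X)
    (hIV : I ⊆ V') (hKC : K ⊆ C') (o : Fin k → Dir) {s t : V} (hs : s ∈ I ∪ X) (ht : t ∈ I ∪ X)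
    (h : ∀ U ⊆ X, U.card = m → RainbowTrail D (List.ofFn o) s t (I ∪ U) K) :
    D.HasAbsorber (vertexSubsets C X m) o V' C' := by
  have htr : ∀ U ⊆ X, U.card = m →
      RainbowTrail (D.restrict (I ∪ X) K) (List.ofFn o) s t (I ∪ U) K := fun U hU hUm =>
    (h U hU hUm).restrict (Finset.union_subset_union_right hU) subset_rfl
  have hcol : (D.restrict (I ∪ X) K).colors = K := by
    obtain ⟨U, hU, hUm⟩ := Finset.exists_subset_card_eq hmX
    exact (colors_restrict_subset _ _).antisymm (htr U hU hUm).subset_colors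
  have hv : (D.restrict (I ∪ X) K).verts \ X = I := Finset.union_sdiff_cancel_right hIX
  refine ⟨D.restrict (I ∪ X) K, s, t, restrict_isSubdigraph (Finset.union_subset hI hX),
    ⟨hk, ?_, ?_, hs, ht, ?_⟩, ?_, ?_⟩
  · intro S hS T hT
    simp only [vertexSubsets, Finset.mem_image, Finset.mem_powersetCard] at hS hT
    obtain ⟨U, ⟨-, hU⟩, rfl⟩ := hS
    obtain ⟨W, ⟨-, hW⟩, rfl⟩ := hT
    exact hU.trans hW.symm
  · intro S hS T hT
    simp only [vertexSubsets, Finset.mem_image] at hS hT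
    obtain ⟨U, -, rfl⟩ := hS
    obtain ⟨W, -, rfl⟩ := hT
    rfl
  · intro S hS
    simp only [vertexSubsets, Finset.mem_image, Finset.mem_powersetCard] at hS
    obtain ⟨U, ⟨hU, hUm⟩, rfl⟩ := hS
    obtain ⟨p, hp, hpv, hpc⟩ := (htr U hU hUm).exists_isRainbowPath o rfl
    refine ⟨p, hp, ?_, ?_⟩
    · rw [hpv, famVerts_vertexSubsets hm hmX, hv]
    · rw [hpc, famColors_vertexSubsets, hcol]
      simp
  · rw [famVerts_vertexSubsets hm hmX, hv]
    exact hIV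
  · rw [famColors_vertexSubsets, hcol, Finset.sdiff_empty]
    exact hKC

end ColoredDigraph

/-! ### Assembling the global absorber in a rich digraph. -/

namespace ColoredDigraph
variable {V C : Type*} [DecidableEq V] [DecidableEq C]
variable {D : ColoredDigraph V C} {M : ℕ}

/-- A family of bounded-size lists of vertices such that the lists can be matched to `Y ∪ U` for
each `m`-subset `U` of `X`. -/
theorem exists_matchable_lists {m : ℕ} (hm : 40 ≤ m) {X Y : Finset V} (hX : X.Nonempty)
    (hXc : X.card ≤ 2 * m) (hYc : Y.card = 2 * m) (hXY : Disjoint Y X) :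
    ∃ v : Fin (3 * m) → Fin 35 → V, (∀ l i, v l i ∈ Y ∪ X) ∧
      ∀ U ⊆ X, U.card = m → ∃ θ : Fin (3 * m) → Fin 35,
        Function.Injective (fun l => v l (θ l)) ∧
        Finset.univ.image (fun l => v l (θ l)) = Y ∪ U := by
  obtain ⟨nbr, hnbr⟩ := exists_robustly_matchable hm
  obtain ⟨x, hx⟩ := exists_fin_range_eq X hX hXc
  obtain ⟨y, hy⟩ := exists_fin_range_eq Y (Finset.card_pos.1 (by omega)) hYc.le
  have hyY : Finset.univ.image y = Y := by
    ext z; simp [hy]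
  have hyi : Function.Injective y := by
    rw [← Set.injOn_univ, ← Finset.coe_univ, ← Finset.card_image_iff, hyY, hYc]
    simp
  refine ⟨fun l i => Sum.elim y x (nbr l i), fun l i => ?_, fun U hU hUm => ?_⟩
  · rcases h : nbr l i with z | z
    · exact Finset.mem_union_left _ ((hy _).2 ⟨z, by simp [h]⟩)
    · exact Finset.mem_union_right _ ((hx _).2 ⟨z, by simp [h]⟩)
  -- `X` may have fewer than `2m` vertices, so several labels can name the same one; one label is
  -- chosen for each vertex of `U`. The matching uses only these labels on the `X` side, hence stays
  -- injective.
  · obtain ⟨U', -, hinj, rfl⟩ : ∃ U' ⊆ (Finset.univ : Finset (Fin (2 * m))),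
        Set.InjOn x U' ∧ U'.image x = U := by
      have : (U : Set V) ⊆ x '' ((Finset.univ : Finset (Fin (2 * m))) : Set (Fin (2 * m))) := by
        intro z hz
        obtain ⟨i, rfl⟩ := (hx z).1 (hU hz)
        exact ⟨i, by simp, rfl⟩
      obtain ⟨W, hW, hWi, hWU⟩ := Finset.exists_subset_injOn_image_eq_of_surjOn _ U this
      exact ⟨W, hW, hWi, hWU⟩
    rw [Finset.card_image_iff.2 hinj] at hUm
    obtain ⟨θ, hθ, hθU⟩ := hnbr U' hUm
    have hmem : ∀ l, nbr l (θ l) ∈ Finset.univ.image Sum.inl ∪ U'.image Sum.inr := fun l =>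
      hθU ▸ Finset.mem_image_of_mem _ (Finset.mem_univ l)
    have hYX : ∀ a b, y a ≠ x b := fun a b h =>
      Finset.disjoint_left.1 hXY ((hy _).2 ⟨a, rfl⟩) (h ▸ (hx _).2 ⟨b, rfl⟩)
    refine ⟨θ, fun l l' h => hθ ?_, ?_⟩
    · have h1 := hmem l
      have h2 := hmem l'
      dsimp only at h ⊢
      rcases e : nbr l (θ l) with a | a <;> rcases e' : nbr l' (θ l') with b | b <;>
        rw [e] at h h1 <;> rw [e'] at h h2
      · exact congrArg _ (hyi h)
      · exact absurd h (hYX a b)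
      · exact absurd h.symm (hYX b a)
      · exact congrArg _ (hinj (by simpa using h1) (by simpa using h2) h)
    · have : (fun l => Sum.elim y x (nbr l (θ l))) = Sum.elim y x ∘ fun l => nbr l (θ l) := rfl
      rw [this, ← Finset.image_image, hθU, Finset.image_union, Finset.image_image,
        Finset.image_image, Sum.elim_comp_inl, Sum.elim_comp_inr, hyY]

/-- Rich digraphs contain vertex absorbers for all `m`-subsets of a given set. -/
theorem Rich.hasAbsorber (hR : Rich D M 35) {m : ℕ} (hm : 40 ≤ m) {X V' : Finset V}
    {C' : Finset C} (hX : X ⊆ D.verts) (hV' : V' ⊆ D.verts) (hmX : m ≤ X.card)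
    (hXm : X.card ≤ 2 * m) (hY : 4 * m ≤ V'.card)
    (hMV : (D.verts \ V').card + 9000 * m + 3000 ≤ M)
    (hMC : (D.colors \ C').card + 9000 * m + 3000 ≤ M) {k : ℕ} (hk : k + 3 = 2825 * (3 * m))
    (o : Fin k → Dir) : D.HasAbsorber (vertexSubsets C X m) o V' C' := by
  obtain ⟨Y, hYV, hYc⟩ := Finset.exists_subset_card_eq
    (show 2 * m ≤ (V' \ X).card by have := Finset.le_card_sdiff X V'; omega)
  have hYX : Disjoint Y X := Finset.disjoint_of_subset_left hYV Finset.sdiff_disjoint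
  have hYV' : Y ⊆ V' := hYV.trans Finset.sdiff_subset
  obtain ⟨v, hvm, hv⟩ := exists_matchable_lists hm (Finset.card_pos.1 (by omega)) hXm hYc hYX
  have hvD : ∀ l i, v l i ∈ D.verts := fun l i =>
    Finset.union_subset (hYV'.trans hV') hX (hvm l i)
  -- A list piece with 35 options has `70 * 34 + 52 = 2432` edges, plus 3 for its link. The `3m`
  -- pieces use `7305 * m` of the `8475 * m - 3` edges, and the rest is padding.
  obtain ⟨o₁, o₂, ho, ho₁, ho₂⟩ : ∃ o₁ o₂, List.ofFn o = o₁ ++ o₂ ∧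
      o₁.length = 1170 * m - 3 ∧ o₂.length = 3 * m * (2432 + 3) :=
    ⟨(List.ofFn o).take (1170 * m - 3), (List.ofFn o).drop (1170 * m - 3), by simp,
      by simp; omega, by simp; omega⟩
  set FV := (D.verts \ V') ∪ (Y ∪ X) with hFV
  set FC := D.colors \ C' with hFC
  have cF : FV.card ≤ (D.verts \ V').card + (2 * m + 2 * m) :=
    (Finset.card_union_le _ _).trans (Nat.add_le_add_left
      ((Finset.card_union_le _ _).trans (Nat.add_le_add hYc.le hXm)) _)
  obtain ⟨s, hs, hsF⟩ : ∃ s ∈ D.verts, s ∉ FV := by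
    obtain ⟨a, b, w, ha, -, -, hH, -⟩ := hR.hub FV FC (by omega) (by omega) .fwd .fwd
    exact ⟨a, (arc_mem_verts (hH.left_mem 0)).1, ha⟩
  obtain ⟨t₁, P, Q, hp, hP, hQ⟩ := hR.exists_trail o₁ hs FV FC hsF (by omega) (by omega)
  have cP := hp.card_verts
  have cQ := hp.card_colors
  have cFP := Finset.card_union_le FV P
  have cFQ := Finset.card_union_le FC Q
  -- The options of the whole chain: all choices of one list entry per piece without a repeated
  -- vertex. Injectivity makes the absorbed vertices of distinct pieces disjoint.
  let ι := {θ : Fin (3 * m) → Fin 35 // Function.Injective fun l => v l (θ l)}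
  obtain ⟨U₀, hU₀, hU₀m⟩ := Finset.exists_subset_card_eq hmX
  have : Nonempty ι := by
    obtain ⟨θ, hθ, -⟩ := hv U₀ hU₀ hU₀m
    exact ⟨⟨θ, hθ⟩⟩
  have hvF : ∀ l i, v l i ∈ FV := fun l i => Finset.mem_union_right _ (hvm l i)
  -- `2900 = 80 * 35 + 100` is the loss in `Rich.avail_local`.
  obtain ⟨t, I, K, hI, hK, -, -, hfin⟩ := hR.exists_chain (M₁ := M - 2900) (ℓ := 2432)
    (Finset.univ : Finset (Fin (3 * m))) (fun l (θ : ι) => {v l (θ.1 l)}) (fun _ _ => ∅)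
    (Nat.sub_le _ _)
    (fun l _ => (hR.avail_local (q := 34) rfl (hvD l) (by omega)).comp (fun θ : ι => θ.1 l)
      (fun _ => rfl) (fun _ => rfl))
    (fun _ => hp) (FV ∪ P) (FC ∪ Q) (fun _ => Finset.subset_union_right)
    (fun _ => Finset.subset_union_right)
    (fun l _ θ => Finset.singleton_subset_iff.2 (Finset.mem_union_left _ (hvF _ _)))
    (fun _ _ _ => Finset.empty_subset _)
    (fun θ l _ => Finset.disjoint_singleton_right.2
      fun h => Finset.disjoint_left.1 hP h (hvF _ _))
    (fun _ _ _ => Finset.disjoint_empty_right _)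
    (fun θ l _ l' _ hne => Finset.disjoint_singleton.2 fun h => hne (θ.2 h))
    (fun _ _ _ _ _ _ => Finset.disjoint_empty_right _)
    (by rw [Finset.card_univ, Fintype.card_fin]; omega)
    (by rw [Finset.card_univ, Fintype.card_fin]; omega) o₂
    (by rw [Finset.card_univ, Fintype.card_fin, ho₂])
  simp only [Finset.disjoint_union_right] at hI hK
  have key : ∀ U ⊆ X, U.card = m →
      RainbowTrail D (List.ofFn o) s t (P ∪ Y ∪ I ∪ U) (Q ∪ K) := by
    intro U hU hUm
    obtain ⟨θ, hθ, hθU⟩ := hv U hU hUm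
    refine (hfin ⟨θ, hθ⟩).congr ho.symm ?_ ?_
    · rw [Finset.biUnion_singleton, hθU]
      ac_rfl
    · rw [biUnion_const_empty, Finset.union_empty]
  have hk₀ := key U₀ hU₀ hU₀m
  have hsub : P ∪ Y ∪ I ∪ U₀ ⊆ P ∪ Y ∪ I ∪ X := Finset.union_subset_union_right hU₀
  have hout : ∀ {W : Finset V}, W ⊆ D.verts → Disjoint W FV → W ⊆ V' := by
    intro W hW hd x hx
    by_contra h
    exact Finset.disjoint_left.1 hd hx
      (Finset.mem_union_left _ (Finset.mem_sdiff.2 ⟨hW hx, h⟩))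
  have hIPD : P ∪ Y ∪ I ⊆ D.verts := Finset.subset_union_left.trans hk₀.subset_verts
  refine hasAbsorber_of_trails (by omega) (by omega) hmX hX hIPD ?_ ?_ ?_ o (hsub hk₀.start_mem)
    (hsub hk₀.finish_mem) key
  · have hXF : X ⊆ FV := Finset.subset_union_right.trans Finset.subset_union_right
    simp only [Finset.disjoint_union_left]
    exact ⟨⟨hP.mono_right hXF, hYX⟩, hI.1.mono_right hXF⟩
  · refine Finset.union_subset (Finset.union_subset (hout ?_ hP) hYV') (hout ?_ hI.1)
    · exact (Finset.subset_union_left.trans Finset.subset_union_left).trans hIPD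
    · exact Finset.subset_union_right.trans hIPD
  · intro c hc
    by_contra h
    refine Finset.disjoint_left.1 (Finset.disjoint_union_left.2 ⟨hQ, hK.1⟩) hc
      (Finset.mem_sdiff.2 ⟨hk₀.subset_colors hc, h⟩)

end ColoredDigraph

/-! ### Links and swaps in pseudorandom digraphs. -/

/-- The opposite direction. -/
def Dir.flip : Dir → Dir
  | .fwd => .bwd
  | .bwd => .fwd

theorem arc_flip {V : Type*} (d : Dir) (u v : V) : arc d.flip u v = arc d v u := by
  cases d <;> rfl

/-- A set in which every element conflicts with few others has a conflict-free sequence. -/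
theorem exists_pairwise_not_conflict {α : Type*} [DecidableEq α] (conf : α → α → Prop)
    [DecidableRel conf] (hsymm : ∀ x y, conf x y → conf y x) (T : Finset α) {q : ℝ}
    (hq : ∀ x ∈ T, ((T.filter (conf x)).card : ℝ) ≤ q) {d : ℕ} (hd : d * q < T.card)
    (hq0 : 0 ≤ q) :
    ∃ w : Fin d → α, (∀ i, w i ∈ T) ∧ ∀ i j, i ≠ j → ¬ conf (w i) (w j) := by
  induction d with
  | zero => exact ⟨fun i => i.elim0, fun i => i.elim0, fun i => i.elim0⟩
  | succ d ih =>
    push_cast at hd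
    obtain ⟨w, hwT, hw⟩ := ih (by nlinarith)
    have hc : ((Finset.univ.biUnion fun i => T.filter (conf (w i))).card : ℝ) ≤ d * q := by
      refine (Nat.cast_le.2 Finset.card_biUnion_le).trans ?_
      rw [Nat.cast_sum]
      refine (Finset.sum_le_card_nsmul _ _ q fun i _ => hq _ (hwT i)).trans ?_
      simp
    obtain ⟨x, hxT, hx⟩ := Finset.exists_mem_notMem_of_card_lt_card
      (s := Finset.univ.biUnion fun i => T.filter (conf (w i))) (t := T) (by
        have : ((Finset.univ.biUnion fun i => T.filter (conf (w i))).card : ℝ) < T.card := by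
          linarith
        exact_mod_cast this)
    have hx' : ∀ i, ¬ conf (w i) x := fun i h =>
      hx (Finset.mem_biUnion.2 ⟨i, Finset.mem_univ i, Finset.mem_filter.2 ⟨hxT, h⟩⟩)
    refine ⟨Fin.cons x w, fun i => ?_, fun i j => ?_⟩
    · refine Fin.cases hxT (fun i => ?_) i
      simpa using hwT i
    · refine Fin.cases ?_ (fun i => ?_) i <;> refine Fin.cases ?_ (fun j => ?_) j
      · simp
      · exact fun _ h => hx' j (hsymm _ _ h)
      · exact fun _ h => hx' i h
      · exact fun hne => hw i j (fun h => hne (by rw [h]))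

theorem exists_mem_and_four {α : Type*} [DecidableEq α] {Z : Finset α} {p₁ p₂ p₃ p₄ : α → Prop}
    [DecidablePred p₁] [DecidablePred p₂] [DecidablePred p₃] [DecidablePred p₄] {r : ℕ}
    (h₁ : (Z.filter fun z => ¬ p₁ z).card < r) (h₂ : (Z.filter fun z => ¬ p₂ z).card < r)
    (h₃ : (Z.filter fun z => ¬ p₃ z).card < r) (h₄ : (Z.filter fun z => ¬ p₄ z).card < r)
    (hZ : 4 * r ≤ Z.card) : ∃ z ∈ Z, p₁ z ∧ p₂ z ∧ p₃ z ∧ p₄ z := by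
  obtain ⟨z, hz, hz'⟩ := Finset.exists_mem_notMem_of_card_lt_card
    (s := (Z.filter fun z => ¬ p₁ z) ∪ (Z.filter fun z => ¬ p₂ z) ∪ (Z.filter fun z => ¬ p₃ z) ∪
      (Z.filter fun z => ¬ p₄ z)) (t := Z) (by
    have := Finset.card_union_le ((Z.filter fun z => ¬ p₁ z) ∪ (Z.filter fun z => ¬ p₂ z) ∪
      (Z.filter fun z => ¬ p₃ z)) (Z.filter fun z => ¬ p₄ z)
    have := Finset.card_union_le ((Z.filter fun z => ¬ p₁ z) ∪ (Z.filter fun z => ¬ p₂ z))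
      (Z.filter fun z => ¬ p₃ z)
    have := Finset.card_union_le (Z.filter fun z => ¬ p₁ z) (Z.filter fun z => ¬ p₂ z)
    omega)
  simp only [Finset.mem_union, Finset.mem_filter, hz, true_and, not_or, not_not] at hz'
  exact ⟨z, hz, hz'.1.1.1, hz'.1.1.2, hz'.1.2, hz'.2⟩

namespace ColoredDigraph
variable {V C : Type*} [DecidableEq V] [DecidableEq C]
variable {D : ColoredDigraph V C} {n : ℕ} {α ε : ℝ}

/-- Every vertex sends edges of many distinct allowed colors to allowed vertices. -/
theorem IsPseudorandom.exists_star (hD : D.IsPseudorandom n α ε) {v : V} (hv : v ∈ D.verts)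
    (d : Dir) (FV : Finset V) (FC : Finset C) {r : ℕ}
    (h : (FV.card + FC.card + r : ℝ) ≤ α * n / 2) :
    ∃ N : Finset V, N.card = r ∧ Disjoint N FV ∧ (∀ u ∈ N, arc d v u ∈ D.edges) ∧
      (∀ u ∈ N, D.color (arc d v u) ∉ FC) ∧
      (N.image fun u => D.color (arc d v u)).card = r := by
  have hcol := hD.color_diversity v hv d
  have hsurj : Set.SurjOn (fun u => D.color (arc d v u)) (D.nbhd d v) (D.colorsAt d v \ FC) := by
    intro c hc
    obtain ⟨u, hu, rfl⟩ := Finset.mem_image.1 hc.1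
    exact ⟨u, hu, rfl⟩
  -- One neighbor is kept per allowed color, so deleting the vertices of `FV` costs at most one
  -- color each.
  obtain ⟨W, hW, hWi, hWc⟩ := Finset.exists_subset_injOn_image_eq_of_surjOn _
    (D.colorsAt d v \ FC) (by simpa using hsurj)
  have h1 := Finset.le_card_sdiff FC (D.colorsAt d v)
  have h2 := Finset.le_card_sdiff FV W
  rw [← hWc, Finset.card_image_of_injOn hWi] at h1
  have h3 : FV.card + FC.card + r ≤ (D.colorsAt d v).card := by exact_mod_cast h.trans hcol
  obtain ⟨N, hN, hNc⟩ := Finset.exists_subset_card_eq (show r ≤ (W \ FV).card by omega)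
  have hNW : N ⊆ W := hN.trans Finset.sdiff_subset
  refine ⟨N, hNc, Finset.disjoint_of_subset_left hN Finset.sdiff_disjoint, fun u hu => ?_,
    fun u hu => ?_, ?_⟩
  · exact (Finset.mem_filter.1 (hW (hNW hu))).2
  · have := Finset.mem_image_of_mem (fun u => D.color (arc d v u)) (hNW hu)
    rw [hWc] at this
    exact (Finset.mem_sdiff.1 this).2
  · rw [Finset.card_image_of_injOn (hWi.mono (by exact_mod_cast hNW)), hNc]

/-- Few vertices send no edge with a color in `K` to `N`. -/
theorem IsPseudorandom.card_filter_lt (hD : D.IsPseudorandom n α ε) {r : ℕ} (hr : ε * n ≤ r)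
    {Z N : Finset V} {K : Finset C} (hZ : Z ⊆ D.verts) (hN : N ⊆ D.verts) (hK : K ⊆ D.colors)
    (hNr : r ≤ N.card) (hKr : r ≤ K.card) (d : Dir) :
    (Z.filter fun z => ¬ ∃ a ∈ N, arc d z a ∈ D.edges ∧ D.color (arc d z a) ∈ K).card < r := by
  by_contra h
  obtain ⟨z, hz, a, ha, hza, hc⟩ := hD.exists_edge
    (Z.filter fun z => ¬ ∃ a ∈ N, arc d z a ∈ D.edges ∧ D.color (arc d z a) ∈ K)
    ((Finset.filter_subset _ Z).trans hZ) N hN K hK (hr.trans (Nat.cast_le.2 (not_lt.1 h)))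
    (hr.trans (Nat.cast_le.2 hNr)) (hr.trans (Nat.cast_le.2 hKr)) d
  exact (Finset.mem_filter.1 hz).2 ⟨a, ha, hza, hc⟩

omit [DecidableEq V] [DecidableEq C] in
theorem isHub_bool {d₁ d₂ : Dir} {a b w₁ w₂ : V} (hab : a ≠ b) (hw : w₁ ≠ w₂)
    (h₁ : arc d₁ a w₁ ∈ D.edges) (h₂ : arc d₂ w₁ b ∈ D.edges) (h₃ : arc d₁ a w₂ ∈ D.edges)
    (h₄ : arc d₂ w₂ b ∈ D.edges)
    (hnd : [D.color (arc d₁ a w₁), D.color (arc d₂ w₁ b), D.color (arc d₁ a w₂),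
      D.color (arc d₂ w₂ b)].Nodup) :
    IsHub D d₁ d₂ a b (fun i : Bool => if i then w₁ else w₂) := by
  simp only [List.nodup_cons, List.mem_cons, List.not_mem_nil, or_false, not_or] at hnd
  obtain ⟨⟨n12, n13, n14⟩, ⟨n23, n24⟩, n34, -⟩ := hnd
  refine ⟨hab, ?_, ?_, ?_, ?_, ?_, ?_⟩
  · rintro (_ | _) (_ | _) h <;> simp_all
  · rintro (_ | _) <;> simpa
  · rintro (_ | _) <;> simpa
  · rintro (_ | _) (_ | _) h <;> simp_all
  · rintro (_ | _) (_ | _) h <;> simp_all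
  · rintro (_ | _) (_ | _) <;> simp_all [eq_comm]

omit [DecidableEq V] in
theorem hubColors_bool (d₁ d₂ : Dir) (a b w₁ w₂ : V) :
    hubColors D d₁ d₂ a b (fun i : Bool => if i then w₁ else w₂) =
      {D.color (arc d₁ a w₁), D.color (arc d₂ w₁ b), D.color (arc d₁ a w₂),
        D.color (arc d₂ w₂ b)} := by
  ext x
  simp [hubColors]
  tauto

omit [DecidableEq V] in
-- Each color avoids `F` and the palettes of all earlier colors, so the eight are distinct and
-- outside `F`. The last one needs no palette, as nothing comes after it.
theorem swap_colors {F K₁ K₂ K₃ K₄ L₁ L₂ L₃ : Finset C} {x₁ x₂ x₃ x₄ x₅ x₆ x₇ x₈ : C}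
    (m₁ : x₁ ∈ K₁) (m₂ : x₂ ∈ K₂) (m₃ : x₃ ∈ K₃) (m₄ : x₄ ∈ K₄) (m₅ : x₅ ∈ L₁) (m₆ : x₆ ∈ L₂)
    (m₇ : x₇ ∈ L₃) (t₁ : x₁ ∉ F) (t₂ : x₂ ∉ F ∪ K₁) (t₃ : x₃ ∉ F ∪ K₁ ∪ K₂)
    (t₄ : x₄ ∉ F ∪ K₁ ∪ K₂ ∪ K₃) (t₅ : x₅ ∉ F ∪ K₁ ∪ K₂ ∪ K₃ ∪ K₄)
    (t₆ : x₆ ∉ F ∪ K₁ ∪ K₂ ∪ K₃ ∪ K₄ ∪ L₁) (t₇ : x₇ ∉ F ∪ K₁ ∪ K₂ ∪ K₃ ∪ K₄ ∪ L₁ ∪ L₂)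
    (t₈ : x₈ ∉ F ∪ K₁ ∪ K₂ ∪ K₃ ∪ K₄ ∪ L₁ ∪ L₂ ∪ L₃) :
    [x₁, x₂, x₅, x₆].Nodup ∧ [x₇, x₈, x₃, x₄].Nodup ∧
      Disjoint ({x₁, x₂, x₅, x₆} : Finset C) {x₇, x₈, x₃, x₄} ∧
      Disjoint ({x₁, x₂, x₅, x₆} : Finset C) F ∧ Disjoint ({x₇, x₈, x₃, x₄} : Finset C) F := by
  simp only [Finset.mem_union, not_or] at t₂ t₃ t₄ t₅ t₆ t₇ t₈
  simp only [List.nodup_cons, List.mem_cons, List.not_mem_nil, or_false, not_or,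
    Finset.disjoint_insert_left, Finset.disjoint_singleton_left, Finset.mem_insert,
    Finset.mem_singleton]
  and_intros <;> grind

theorem mul_add_le_of_le_half {M r : ℕ} (hα : α ≤ 1)
    (hM : (2 * M + 20 * r + 20 : ℝ) ≤ α * n / 2) : 4 * M + 40 * r + 40 ≤ n := by
  have : (4 * M + 40 * r + 40 : ℝ) ≤ n := by
    have : α * n ≤ 1 * n := mul_le_mul_of_nonneg_right hα (Nat.cast_nonneg n)
    linarith
  exact_mod_cast this

section

variable {M r : ℕ} (hD : D.IsPseudorandom n α ε) (hα : α ≤ 1) (hr : ε * n ≤ r)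
  (hM : (2 * M + 20 * r + 20 : ℝ) ≤ α * n / 2)
include hD hα hr hM

/-- Take stars of size `r ≥ ε n` at `s` and `t` with disjoint color sets; the edge condition joins
their leaf sets by an edge with a color outside both. -/
theorem IsPseudorandom.link {FV : Finset V} {FC : Finset C} (hFV : FV.card ≤ M)
    (hFC : FC.card ≤ M) {s t : V} (hs : s ∈ D.verts) (ht : t ∈ D.verts) (d₁ d₂ d₃ : Dir) :
    ∃ x y : V, x ∉ FV ∧ y ∉ FV ∧
      arc d₁ s x ∈ D.edges ∧ arc d₂ x y ∈ D.edges ∧ arc d₃ y t ∈ D.edges ∧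
      D.color (arc d₁ s x) ∉ FC ∧ D.color (arc d₂ x y) ∉ FC ∧ D.color (arc d₃ y t) ∉ FC ∧
      D.color (arc d₁ s x) ≠ D.color (arc d₂ x y) ∧
      D.color (arc d₁ s x) ≠ D.color (arc d₃ y t) ∧
      D.color (arc d₂ x y) ≠ D.color (arc d₃ y t) := by
  have hn := mul_add_le_of_le_half hα hM
  have hst : ∀ {a b : ℕ}, a ≤ M + 3 * r → b ≤ M + 3 * r → (a + b + r : ℝ) ≤ α * n / 2 := by
    intro a b ha hb
    have : a + b + r ≤ 2 * M + 20 * r + 20 := by omega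
    have : (a + b + r : ℝ) ≤ 2 * M + 20 * r + 20 := by exact_mod_cast this
    linarith
  obtain ⟨N₁, c1, f1, e1, k1, i1⟩ := hD.exists_star hs d₁ FV FC (r := r)
    (hst (by omega) (by omega))
  set K₁ := N₁.image fun u => D.color (arc d₁ s u)
  have u1 := Finset.card_union_le FC K₁
  obtain ⟨N₂, c2, f2, e2, k2, i2⟩ := hD.exists_star ht d₃.flip FV (FC ∪ K₁) (r := r)
    (hst (by omega) (by omega))
  simp only [arc_flip] at e2 k2 i2
  set K₂ := N₂.image fun u => D.color (arc d₃ u t)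
  have u2 := Finset.card_union_le (FC ∪ K₁) K₂
  have h := Finset.le_card_sdiff (FC ∪ K₁ ∪ K₂) D.colors
  rw [hD.card_colors] at h
  obtain ⟨x, hx, y, hy, hxy, hc⟩ := hD.exists_edge N₁ (fun u hu => (arc_mem_verts (e1 u hu)).2) N₂
    (fun u hu => (arc_mem_verts (e2 u hu)).1) _ Finset.sdiff_subset
    (hr.trans (Nat.cast_le.2 c1.ge)) (hr.trans (Nat.cast_le.2 c2.ge))
    (hr.trans (Nat.cast_le.2 (show r ≤ (D.colors \ (FC ∪ K₁ ∪ K₂)).card by omega))) d₂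
  have hx1 : D.color (arc d₁ s x) ∈ K₁ := Finset.mem_image_of_mem _ hx
  have hy1 : D.color (arc d₃ y t) ∈ K₂ := Finset.mem_image_of_mem (fun u => D.color (arc d₃ u t)) hy
  have hy2 := k2 y hy
  simp only [Finset.mem_sdiff, Finset.mem_union, not_or] at hc hy2
  exact ⟨x, y, Finset.disjoint_left.1 f1 hx, Finset.disjoint_left.1 f2 hy, e1 x hx, hxy, e2 y hy,
    k1 x hx, hc.2.1.1, hy2.1, fun h => hc.2.1.2 (h ▸ hx1), fun h => hy2.2 (h ▸ hx1),
    fun h => hc.2.2 (h ▸ hy1)⟩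

-- Fix disjoint stars of candidates for `a₁, b₁` around `v₁` and for `a₂, b₂` around `v₂`, and four
-- disjoint palettes for the edges at `z`. By the edge condition fewer than `r` vertices have no
-- suitable edge to a given star in its palette, so some `z` works for all four.
set_option maxHeartbeats 1000000 in
theorem IsPseudorandom.swap {FV : Finset V} {FC : Finset C} (hFV : FV.card ≤ M)
    (hFC : FC.card ≤ M) {v₁ v₂ : V} (hv₁ : v₁ ∈ D.verts) (hv₂ : v₂ ∈ D.verts)
    (d₁ d₂ e₁ e₂ : Dir) : ∃ a₁ b₁ a₂ b₂ z : V,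
      a₁ ∉ FV ∧ b₁ ∉ FV ∧ a₂ ∉ FV ∧ b₂ ∉ FV ∧ z ∉ FV ∧
      Disjoint ({a₁, b₁} : Finset V) {a₂, b₂} ∧
      IsHub D d₁ d₂ a₁ b₁ (fun b : Bool => if b then v₁ else z) ∧
      IsHub D e₁ e₂ a₂ b₂ (fun b : Bool => if b then z else v₂) ∧
      Disjoint (hubColors D d₁ d₂ a₁ b₁ (fun b : Bool => if b then v₁ else z))
        (hubColors D e₁ e₂ a₂ b₂ (fun b : Bool => if b then z else v₂)) ∧
      Disjoint (hubColors D d₁ d₂ a₁ b₁ (fun b : Bool => if b then v₁ else z)) FC ∧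
      Disjoint (hubColors D e₁ e₂ a₂ b₂ (fun b : Bool => if b then z else v₂)) FC := by
  have hn := mul_add_le_of_le_half hα hM
  have hst : ∀ {a b : ℕ}, a ≤ M + 3 * r → b ≤ M + 3 * r → (a + b + r : ℝ) ≤ α * n / 2 := by
    intro a b ha hb
    have : a + b + r ≤ 2 * M + 20 * r + 20 := by omega
    have : (a + b + r : ℝ) ≤ 2 * M + 20 * r + 20 := by exact_mod_cast this
    linarith
  obtain ⟨A₁, c1, f1, g1, k1, i1⟩ := hD.exists_star hv₁ d₁.flip FV FC (r := r)
    (hst (by omega) (by omega))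
  simp only [arc_flip] at g1 k1 i1
  set K₁ := A₁.image fun u => D.color (arc d₁ u v₁)
  have p1 := Finset.card_union_le FV A₁
  have u1 := Finset.card_union_le FC K₁
  obtain ⟨B₁, c2, f2, g2, k2, i2⟩ := hD.exists_star hv₁ d₂ (FV ∪ A₁) (FC ∪ K₁) (r := r)
    (hst (by omega) (by omega))
  set K₂ := B₁.image fun u => D.color (arc d₂ v₁ u)
  have p2 := Finset.card_union_le (FV ∪ A₁) B₁
  have u2 := Finset.card_union_le (FC ∪ K₁) K₂
  obtain ⟨A₂, c3, f3, g3, k3, i3⟩ := hD.exists_star hv₂ e₁.flip (FV ∪ A₁ ∪ B₁) (FC ∪ K₁ ∪ K₂)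
    (r := r) (hst (by omega) (by omega))
  simp only [arc_flip] at g3 k3 i3
  set K₃ := A₂.image fun u => D.color (arc e₁ u v₂)
  have p3 := Finset.card_union_le (FV ∪ A₁ ∪ B₁) A₂
  have u3 := Finset.card_union_le (FC ∪ K₁ ∪ K₂) K₃
  obtain ⟨B₂, c4, f4, g4, k4, i4⟩ := hD.exists_star hv₂ e₂ (FV ∪ A₁ ∪ B₁ ∪ A₂)
    (FC ∪ K₁ ∪ K₂ ∪ K₃) (r := r) (hst (by omega) (by omega))
  set K₄ := B₂.image fun u => D.color (arc e₂ v₂ u)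
  have u4 := Finset.card_union_le (FC ∪ K₁ ∪ K₂ ∪ K₃) K₄
  set F := FC ∪ K₁ ∪ K₂ ∪ K₃ ∪ K₄
  have hpart : ∀ F' : Finset C, F'.card ≤ M + 7 * r → ∃ K ⊆ D.colors \ F', K.card = r := by
    intro F' hF'
    refine Finset.exists_subset_card_eq ?_
    have := Finset.le_card_sdiff F' D.colors
    rw [hD.card_colors] at this
    omega
  obtain ⟨L₁, hL₁, l1⟩ := hpart F (by omega)
  have w1 := Finset.card_union_le F L₁
  obtain ⟨L₂, hL₂, l2⟩ := hpart (F ∪ L₁) (by omega)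
  have w2 := Finset.card_union_le (F ∪ L₁) L₂
  obtain ⟨L₃, hL₃, l3⟩ := hpart (F ∪ L₁ ∪ L₂) (by omega)
  have w3 := Finset.card_union_le (F ∪ L₁ ∪ L₂) L₃
  obtain ⟨L₄, hL₄, l4⟩ := hpart (F ∪ L₁ ∪ L₂ ∪ L₃) (by omega)
  set Z := D.verts \ (FV ∪ {v₁, v₂}) with hZ
  have hZc : 5 * r < Z.card := by
    have h1 := Finset.le_card_sdiff (FV ∪ {v₁, v₂}) D.verts
    have h2 := Finset.card_union_le FV {v₁, v₂}
    have h3 : ({v₁, v₂} : Finset V).card ≤ 2 := Finset.card_le_two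
    rw [hD.card_verts, ← hZ] at h1
    omega
  have hbad := fun {N : Finset V} {K : Finset C} => hD.card_filter_lt (N := N) (K := K) hr
    (show Z ⊆ D.verts from Finset.sdiff_subset)
  have b1 := hbad (fun u hu => (arc_mem_verts (g1 u hu)).1) (hL₁.trans Finset.sdiff_subset)
    c1.ge l1.ge d₁.flip
  have b2 := hbad (fun u hu => (arc_mem_verts (g2 u hu)).2) (hL₂.trans Finset.sdiff_subset)
    c2.ge l2.ge d₂
  have b3 := hbad (fun u hu => (arc_mem_verts (g3 u hu)).1) (hL₃.trans Finset.sdiff_subset)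
    c3.ge l3.ge e₁.flip
  have b4 := hbad (fun u hu => (arc_mem_verts (g4 u hu)).2) (hL₄.trans Finset.sdiff_subset)
    c4.ge l4.ge e₂
  simp only [arc_flip] at b1 b3
  obtain ⟨z, hzZ, hz⟩ : ∃ z ∈ Z, (∃ a ∈ A₁, arc d₁ a z ∈ D.edges ∧ D.color (arc d₁ a z) ∈ L₁) ∧
      (∃ a ∈ B₁, arc d₂ z a ∈ D.edges ∧ D.color (arc d₂ z a) ∈ L₂) ∧
      (∃ a ∈ A₂, arc e₁ a z ∈ D.edges ∧ D.color (arc e₁ a z) ∈ L₃) ∧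
      (∃ a ∈ B₂, arc e₂ z a ∈ D.edges ∧ D.color (arc e₂ z a) ∈ L₄) :=
    exists_mem_and_four b1 b2 b3 b4 (by omega)
  obtain ⟨⟨a₁, ha₁, q1, q1'⟩, ⟨b₁, hb₁, q2, q2'⟩, ⟨a₂, ha₂, q3, q3'⟩, ⟨b₂, hb₂, q4, q4'⟩⟩ := hz
  have m1 : D.color (arc d₁ a₁ v₁) ∈ K₁ :=
    Finset.mem_image_of_mem (fun u => D.color (arc d₁ u v₁)) ha₁
  have m2 : D.color (arc d₂ v₁ b₁) ∈ K₂ := Finset.mem_image_of_mem _ hb₁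
  have m3 : D.color (arc e₁ a₂ v₂) ∈ K₃ :=
    Finset.mem_image_of_mem (fun u => D.color (arc e₁ u v₂)) ha₂
  have m4 : D.color (arc e₂ v₂ b₂) ∈ K₄ := Finset.mem_image_of_mem _ hb₂
  have t1 := k1 _ ha₁
  have t2 := k2 _ hb₁
  have t3 := k3 _ ha₂
  have t4 := k4 _ hb₂
  have t5 := (Finset.mem_sdiff.1 (hL₁ q1')).2
  have t6 := (Finset.mem_sdiff.1 (hL₂ q2')).2
  have t7 := (Finset.mem_sdiff.1 (hL₃ q3')).2
  have t8 := (Finset.mem_sdiff.1 (hL₄ q4')).2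
  have y1 := Finset.disjoint_left.1 f1 ha₁
  have y2 := Finset.disjoint_left.1 f2 hb₁
  have y3 := Finset.disjoint_left.1 f3 ha₂
  have y4 := Finset.disjoint_left.1 f4 hb₂
  have hz' := (Finset.mem_sdiff.1 hzZ).2
  simp only [Finset.mem_union, Finset.mem_insert, Finset.mem_singleton, not_or] at y2 y3 y4 hz'
  have hnd := swap_colors m1 m2 m3 m4 q1' q2' q3' t1 t2 t3 t4 t5 t6 t7 t8
  refine ⟨a₁, b₁, a₂, b₂, z, y1, y2.1, y3.1.1, y4.1.1.1, hz'.1, ?_,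
    isHub_bool (fun h => y2.2 (h ▸ ha₁)) (Ne.symm hz'.2.1) (g1 _ ha₁) (g2 _ hb₁) q1 q2 ?_,
    isHub_bool (fun h => y4.2 (h ▸ ha₂)) hz'.2.2 q3 q4 (g3 _ ha₂) (g4 _ hb₂) ?_, ?_, ?_, ?_⟩
  · simp only [Finset.disjoint_insert_left, Finset.disjoint_singleton_left, Finset.mem_insert,
      Finset.mem_singleton, not_or]
    refine ⟨⟨fun h => y3.1.2 (h ▸ ha₁), fun h => y4.1.1.2 (h ▸ ha₁)⟩,
      fun h => y3.2 (h ▸ hb₁), fun h => y4.1.2 (h ▸ hb₁)⟩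
  · exact hnd.1
  · exact hnd.2.1
  · rw [hubColors_bool, hubColors_bool]
    exact hnd.2.2.1
  · rw [hubColors_bool]
    exact hnd.2.2.2.1
  · rw [hubColors_bool]
    exact hnd.2.2.2.2

end

end ColoredDigraph

/-! ### Hubs, color gadgets and richness. -/

namespace ColoredDigraph
variable {V C : Type*} [DecidableEq V] [DecidableEq C]
variable {D : ColoredDigraph V C} {n : ℕ} {α ε : ℝ}

theorem IsPseudorandom.card_filter_color_le (hD : D.IsPseudorandom n α ε) {d : Dir} {v : V}
    (hv : v ∈ D.verts) {T : Finset V} (hT : ∀ u ∈ T, arc d v u ∈ D.edges) {c : C}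
    (hc : c ∈ D.colors) :
    ((T.filter fun u => D.color (arc d v u) = c).card : ℝ) ≤ n / Real.log n := by
  refine le_trans (Nat.cast_le.2 (Finset.card_le_card fun u hu => ?_)) (hD.color_degree_le c hc v hv d)
  obtain ⟨hu, huc⟩ := Finset.mem_filter.1 hu
  exact Finset.mem_filter.2 ⟨Finset.mem_filter.2 ⟨(arc_mem_verts (hT u hu)).2, hT u hu⟩, huc⟩

/-- Two vertices with many common neighbors joined to them by edges of allowed colors. -/
theorem IsPseudorandom.exists_common_nbhd (hD : D.IsPseudorandom n α ε) {M R : ℕ}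
    (hR : (2 * M + 4 * R : ℝ) ≤ α * n / 2) {FV : Finset V} {FC : Finset C} (hFV : FV.card ≤ M)
    (hFC : FC.card ≤ M) (hM : M < n) (d₁ d₂ : Dir) :
    ∃ (a b : V) (T : Finset V), a ∈ D.verts ∧ b ∈ D.verts ∧ (n - M) * R ^ 2 ≤ T.card * n ^ 2 ∧
      ∀ y ∈ T, y ∉ FV ∧ a ∉ FV ∧ b ∉ FV ∧ a ≠ b ∧ arc d₁ a y ∈ D.edges ∧ arc d₂ y b ∈ D.edges ∧
        D.color (arc d₁ a y) ∉ FC ∧ D.color (arc d₂ y b) ∉ FC ∧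
        D.color (arc d₁ a y) ≠ D.color (arc d₂ y b) := by
  have key : ∀ y ∈ D.verts, ∃ A B : Finset V, A.card = R ∧ B.card = R ∧
      ∀ a ∈ A, ∀ b ∈ B, a ∉ FV ∧ b ∉ FV ∧ a ≠ b ∧ arc d₁ a y ∈ D.edges ∧ arc d₂ y b ∈ D.edges ∧
        D.color (arc d₁ a y) ∉ FC ∧ D.color (arc d₂ y b) ∉ FC ∧
        D.color (arc d₁ a y) ≠ D.color (arc d₂ y b) := by
    intro y hy
    have hst : ∀ {a b : ℕ}, a ≤ M + R → b ≤ M + R → (a + b + R : ℝ) ≤ α * n / 2 := by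
      intro a b ha hb
      have : a + b + R ≤ 2 * M + 4 * R := by omega
      have : (a + b + R : ℝ) ≤ 2 * M + 4 * R := by exact_mod_cast this
      linarith
    obtain ⟨A, c1, f1, g1, k1, i1⟩ := hD.exists_star hy d₁.flip FV FC (r := R)
      (hst (by omega) (by omega))
    simp only [arc_flip] at g1 k1 i1
    have p1 := Finset.card_union_le FV A
    have u1 := Finset.card_union_le FC (A.image fun u => D.color (arc d₁ u y))
    obtain ⟨B, c2, f2, g2, k2, -⟩ := hD.exists_star hy d₂ (FV ∪ A)
      (FC ∪ A.image fun u => D.color (arc d₁ u y)) (r := R) (hst (by omega) (by omega))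
    refine ⟨A, B, c1, c2, fun a ha b hb => ?_⟩
    have hb1 := Finset.disjoint_left.1 f2 hb
    have hb2 := k2 b hb
    rw [Finset.mem_union, not_or] at hb1 hb2
    exact ⟨Finset.disjoint_left.1 f1 ha, hb1.1, fun h => hb1.2 (h ▸ ha), g1 a ha, g2 b hb, k1 a ha,
      hb2.1, fun h => hb2.2 (h ▸ Finset.mem_image_of_mem (fun u => D.color (arc d₁ u y)) ha)⟩
  choose! A B hA hB hAB using key
  have hs := Finset.sum_card_bipartiteAbove_eq_sum_card_bipartiteBelow (s := D.verts \ FV)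
    (t := D.verts ×ˢ D.verts) (fun (y : V) (p : V × V) => p.1 ∈ A y ∧ p.2 ∈ B y)
  have hl : ∀ y ∈ D.verts \ FV, ((D.verts ×ˢ D.verts).bipartiteAbove
      (fun (y : V) (p : V × V) => p.1 ∈ A y ∧ p.2 ∈ B y) y).card = R ^ 2 := by
    intro y hy
    have hy' := (Finset.mem_sdiff.1 hy).1
    have : (D.verts ×ˢ D.verts).bipartiteAbove (fun (y : V) (p : V × V) => p.1 ∈ A y ∧ p.2 ∈ B y) y =
        A y ×ˢ B y := by
      ext ⟨a, b⟩
      simp only [Finset.mem_bipartiteAbove, Finset.mem_product]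
      refine ⟨fun h => h.2, fun h => ⟨?_, h⟩⟩
      have := hAB y hy' a h.1 b h.2
      exact ⟨(arc_mem_verts this.2.2.2.1).1, (arc_mem_verts this.2.2.2.2.1).2⟩
    rw [this, Finset.card_product, hA y hy', hB y hy', sq]
  rw [Finset.sum_congr rfl hl, Finset.sum_const, smul_eq_mul] at hs
  have hne : (D.verts ×ˢ D.verts).Nonempty := by
    have : D.verts.Nonempty := Finset.card_pos.1 (by rw [hD.card_verts]; omega)
    exact this.product this
  -- Each `y` outside `FV` contributes `R ^ 2` pairs. Averaging over all `n ^ 2` pairs gives one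
  -- pair `(a, b)` that serves at least `(n - M) * R ^ 2 / n ^ 2` vertices `y`.
  obtain ⟨⟨a, b⟩, hab, hle⟩ := Finset.exists_le_of_sum_le (s := D.verts ×ˢ D.verts) hne
    (f := fun _ => ((n - M) * R ^ 2 : ℕ)) (g := fun p => n ^ 2 * ((D.verts \ FV).bipartiteBelow
      (fun (y : V) (p : V × V) => p.1 ∈ A y ∧ p.2 ∈ B y) p).card) (by
    rw [Finset.sum_const, smul_eq_mul, ← Finset.mul_sum, ← hs, Finset.card_product, hD.card_verts,
      sq n]
    have := Finset.le_card_sdiff FV D.verts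
    rw [hD.card_verts] at this
    exact Nat.mul_le_mul_left _ (Nat.mul_le_mul_right _ (by omega)))
  rw [Finset.mem_product] at hab
  refine ⟨a, b, _, hab.1, hab.2, hle.trans_eq (mul_comm _ _), fun y hy => ?_⟩
  rw [Finset.mem_bipartiteBelow, Finset.mem_sdiff] at hy
  exact ⟨hy.1.2, hAB y hy.1.1 a hy.2.1 b hy.2.2⟩

/-- Among the linearly many common neighbors of `a` and `b`, each shares a color with at most `4 n /
log n` others by the color-degree bound, so `d` of them without conflicts can be chosen greedily. -/
theorem IsPseudorandom.hub (hD : D.IsPseudorandom n α ε) {M R d : ℕ}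
    (hR : (2 * M + 4 * R : ℝ) ≤ α * n / 2) (hM : M < n)
    (hd : d * (4 * (n / Real.log n)) * n ^ 2 < ((n : ℝ) - M) * R ^ 2)
    {FV : Finset V} {FC : Finset C} (hFV : FV.card ≤ M) (hFC : FC.card ≤ M) (hd0 : 0 < d)
    (d₁ d₂ : Dir) :
    ∃ (a b : V) (w : Fin d → V), a ∉ FV ∧ b ∉ FV ∧ (∀ i, w i ∉ FV) ∧
      IsHub D d₁ d₂ a b w ∧ Disjoint (hubColors D d₁ d₂ a b w) FC := by
  obtain ⟨a, b, T, ha, hb, hT, hy⟩ := hD.exists_common_nbhd hR hFV hFC hM d₁ d₂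
  have hn : (0 : ℝ) < n := by exact_mod_cast (by omega : 0 < n)
  have hlog : 0 ≤ Real.log n := Real.log_natCast_nonneg n
  have hTc : d * (4 * (n / Real.log n)) < T.card := by
    have h1 : ((n : ℝ) - M) * R ^ 2 ≤ T.card * n ^ 2 := by
      rw [← Nat.cast_sub hM.le]
      exact_mod_cast hT
    exact lt_of_mul_lt_mul_right (hd.trans_le h1) (by positivity)
  let p : V → C := fun y => D.color (arc d₁ a y)
  let q : V → C := fun y => D.color (arc d₂ y b)
  have hcp : ∀ y ∈ T, p y ∈ D.colors := fun y h => color_mem_colors (hy y h).2.2.2.2.1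
  have hcq : ∀ y ∈ T, q y ∈ D.colors := fun y h => color_mem_colors (hy y h).2.2.2.2.2.1
  have hp : ∀ c ∈ D.colors, ((T.filter fun u => p u = c).card : ℝ) ≤ n / Real.log n := fun c hc =>
    hD.card_filter_color_le ha (fun u hu => (hy u hu).2.2.2.2.1) hc
  have hq : ∀ c ∈ D.colors, ((T.filter fun u => q u = c).card : ℝ) ≤ n / Real.log n := by
    intro c hc
    have := hD.card_filter_color_le (d := d₂.flip) (T := T) hb (fun u hu => by
      rw [arc_flip]; exact (hy u hu).2.2.2.2.2.1) hc
    simpa only [arc_flip] using this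
  obtain ⟨w, hwT, hw⟩ := exists_pairwise_not_conflict
    (fun x y => p y = p x ∨ p y = q x ∨ q y = p x ∨ q y = q x)
    (fun x y h => by rcases h with h | h | h | h <;> simp [h]) T
    (q := 4 * (n / Real.log n)) (fun x hx => by
      have hsub : (T.filter fun y => p y = p x ∨ p y = q x ∨ q y = p x ∨ q y = q x) ⊆
          ((T.filter fun y => p y = p x) ∪ (T.filter fun y => p y = q x)) ∪
          ((T.filter fun y => q y = p x) ∪ (T.filter fun y => q y = q x)) := by
        intro y hy
        simp only [Finset.mem_union, Finset.mem_filter] at hy ⊢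
        tauto
      have hc := (Finset.card_le_card hsub).trans ((Finset.card_union_le _ _).trans
        (Nat.add_le_add (Finset.card_union_le _ _) (Finset.card_union_le _ _)))
      refine (Nat.cast_le.2 hc).trans ?_
      push_cast
      linarith [hp _ (hcp x hx), hp _ (hcq x hx), hq _ (hcp x hx), hq _ (hcq x hx)])
    hTc (by positivity)
  have hi := hy _ (hwT ⟨0, hd0⟩)
  refine ⟨a, b, w, hi.2.1, hi.2.2.1, fun i => (hy _ (hwT i)).1, ⟨hi.2.2.2.1, ?_,
    fun i => (hy _ (hwT i)).2.2.2.2.1, fun i => (hy _ (hwT i)).2.2.2.2.2.1, ?_, ?_, ?_⟩, ?_⟩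
  · intro i j h
    by_contra hne
    exact hw i j hne (Or.inl (by rw [h]))
  · intro i j h
    by_contra hne
    exact hw i j hne (Or.inl h.symm)
  · intro i j h
    by_contra hne
    exact hw i j hne (Or.inr (Or.inr (Or.inr h.symm)))
  · intro i j h
    by_cases hij : i = j
    · subst hij
      exact (hy _ (hwT i)).2.2.2.2.2.2.2.2 h
    · exact hw i j hij (Or.inr (Or.inr (Or.inl h.symm)))
  · rw [hubColors, Finset.disjoint_union_left, Finset.disjoint_left, Finset.disjoint_left]
    constructor
    · intro c hc
      obtain ⟨i, -, rfl⟩ := Finset.mem_image.1 hc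
      exact (hy _ (hwT i)).2.2.2.2.2.2.1
    · intro c hc
      obtain ⟨i, -, rfl⟩ := Finset.mem_image.1 hc
      exact (hy _ (hwT i)).2.2.2.2.2.2.2.1

theorem exists_ofFn_eq {β : Type*} {k : ℕ} (l : List β) (hl : l.length = k) :
    ∃ o : Fin k → β, List.ofFn o = l := by
  subst hl
  exact ⟨l.get, List.ofFn_get l⟩

/-- Deleting at most `ν n` forbidden vertices and colors leaves sets large enough for the gadget
hypothesis. Both gadget paths share all vertices, since the absorbed sets contain only a color. -/
theorem IsColorGadgetPseudorandom.avail {ν : ℝ} (hG : D.IsColorGadgetPseudorandom n ν)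
    (hn : D.colors.card = n) {M : ℕ} (hM : (M : ℝ) ≤ ν * n) {c₁ c₂ : C} (hc₁ : c₁ ∈ D.colors)
    (hc₂ : c₂ ∈ D.colors) :
    Avail D M 7 (fun _ : Bool => ∅) (fun b : Bool => {if b then c₁ else c₂}) := by
  intro FV FC hFV hFC l hl
  obtain ⟨o, rfl⟩ := exists_ofFn_eq l hl
  have hlarge : ∀ {a b f : ℕ}, a = n → f ≤ M → a - f ≤ b → (1 - ν) * n ≤ (b : ℝ) := by
    intro a b f ha hf hab
    have h1 : n ≤ b + M := by omega
    have h1 : (n : ℝ) ≤ b + M := by exact_mod_cast h1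
    linarith
  obtain ⟨A, s, t, hAD, hA, hAV, hAC⟩ := hG.2 (D.verts \ FV) Finset.sdiff_subset (D.colors \ FC)
    Finset.sdiff_subset (hlarge hG.1 hFV (Finset.le_card_sdiff FV D.verts))
    (hlarge hn hFC (Finset.le_card_sdiff FC D.colors)) c₁ hc₁ c₂ hc₂ o
  refine ⟨s, t, _, _, Finset.disjoint_of_subset_left hAV Finset.sdiff_disjoint,
    Finset.disjoint_of_subset_left hAC Finset.sdiff_disjoint, fun b => ?_⟩
  obtain ⟨p, hp, hpv, hpc⟩ := hA.exists_path (∅, {if b then c₁ else c₂}) (by cases b <;> simp)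
  exact (hp.rainbowTrail.of_subdigraph hAD).congr rfl hpv hpc

/-- Pseudorandom digraphs are rich. -/
theorem IsPseudorandom.rich (hD : D.IsPseudorandom n α ε) {ν : ℝ}
    (hG : D.IsColorGadgetPseudorandom n ν) (hα : α ≤ 1) {M r R d : ℕ} (hMν : (M : ℝ) ≤ ν * n)
    (hr : ε * n ≤ r) (hM : (2 * M + 20 * r + 20 : ℝ) ≤ α * n / 2)
    (hR : (2 * M + 4 * R : ℝ) ≤ α * n / 2) (hd0 : 0 < d)
    (hd : d * (4 * (n / Real.log n)) * n ^ 2 < ((n : ℝ) - M) * R ^ 2) : Rich D M d where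
  link _ _ hFV hFC _ hs _ ht d₁ d₂ d₃ := hD.link hα hr hM hFV hFC hs ht d₁ d₂ d₃
  gadget _ h₁ _ h₂ := hG.avail hD.card_colors hMν h₁ h₂
  swap _ _ hFV hFC _ h₁ _ h₂ d₁ d₂ e₁ e₂ := hD.swap hα hr hM hFV hFC h₁ h₂ d₁ d₂ e₁ e₂
  hub _ _ hFV hFC d₁ d₂ :=
    hD.hub hR (by have := mul_add_le_of_le_half hα hM; omega) hd hFV hFC hd0 d₁ d₂

end ColoredDigraph

/-! ### Choice of constants. -/

theorem lemma6p2 :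
    ∀ α : ℝ, 0 < α → α ≤ 1 →
    ∃ ν₀ : ℝ, 0 < ν₀ ∧ ∀ ν : ℝ, 0 < ν → ν ≤ ν₀ →
    ∃ μ₀ : ℝ, 0 < μ₀ ∧ ∀ μ : ℝ, 0 < μ → μ ≤ μ₀ →
    ∀ β : ℝ, 0 < β → β ≤ μ →
    ∃ ε₀ : ℝ, 0 < ε₀ ∧ ∀ ε : ℝ, 0 < ε → ε ≤ ε₀ →
    ∃ n₀ : ℕ, ∀ n : ℕ, n₀ ≤ n →
    ∀ (V C : Type*) [DecidableEq V] [DecidableEq C] (D : ColoredDigraph V C),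
      D.IsPseudorandom n α ε →
      D.IsColorGadgetPseudorandom n (4 * ν) →
      ∀ k : ℕ, k + 3 = 2825 * (3 * ⌊μ * n⌋₊) →
      ∀ o : Fin k → Dir,
      ∀ V' ⊆ D.verts, ∀ C' ⊆ D.colors,
        (1 - ν) * n ≤ (V'.card : ℝ) → (1 - ν) * n ≤ (C'.card : ℝ) →
      ∀ X ⊆ D.verts, X.card = ⌊μ * n⌋₊ + ⌊β * n⌋₊ →
        D.HasAbsorber (ColoredDigraph.vertexSubsets C X ⌊μ * n⌋₊) o V' C' := by
  intro α hα0 hα1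
  -- With `M` about `4 ν n ≤ α n / 25`, `r` about `ε n ≤ α n / 1000` and `R` about `α n / 50`, the
  -- stars fit into the color diversity `α n / 2`. The bound on `μ` makes `9000 * m` less than `ν
  -- n`.
  refine ⟨α / 100, by positivity, fun ν hν0 hν => ⟨ν / 10000, by positivity,
    fun μ hμ0 hμ β hβ0 hβ => ⟨α / 1000, by positivity, fun ε hε0 hε => ?_⟩⟩⟩
  obtain ⟨n₁, hn₁⟩ := exists_nat_ge (40 / μ)
  obtain ⟨n₂, hn₂⟩ := exists_nat_ge (4000 / ν)
  obtain ⟨n₃, hn₃⟩ := exists_nat_ge (10000 / α)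
  -- Makes `n / log n` at most `α ^ 2 n / 10 ^ 7`, small enough for a hub with 35 common neighbors.
  obtain ⟨n₄, hn₄⟩ := exists_nat_ge (Real.exp (10000000 / α ^ 2))
  refine ⟨n₁ + n₂ + n₃ + n₄ + 1, fun n hn V C _ _ D hD hG k hk o V' hV' C' hC' hV'c hC'c X hX
    hXc => ?_⟩
  have hnn₁ : (n₁ : ℝ) ≤ n := by exact_mod_cast (by omega : n₁ ≤ n)
  have hnn₂ : (n₂ : ℝ) ≤ n := by exact_mod_cast (by omega : n₂ ≤ n)
  have hnn₃ : (n₃ : ℝ) ≤ n := by exact_mod_cast (by omega : n₃ ≤ n)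
  have hnn₄ : (n₄ : ℝ) ≤ n := by exact_mod_cast (by omega : n₄ ≤ n)
  have hn0 : (0 : ℝ) < n := by exact_mod_cast (by omega : 0 < n)
  have hμn : 40 ≤ μ * n := by
    have := hn₁.trans hnn₁
    rwa [div_le_iff₀ hμ0, mul_comm] at this
  have hνn : 4000 ≤ ν * n := by
    have := hn₂.trans hnn₂
    rwa [div_le_iff₀ hν0, mul_comm] at this
  have hαn : 10000 ≤ α * n := by
    have := hn₃.trans hnn₃
    rwa [div_le_iff₀ hα0, mul_comm] at this
  have hlog : 10000000 / α ^ 2 ≤ Real.log n := by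
    rw [Real.le_log_iff_exp_le hn0]
    exact hn₄.trans hnn₄
  have hμν : μ * n ≤ ν * n / 10000 := by
    rw [le_div_iff₀ (by norm_num)]
    nlinarith
  have hνα : ν * n ≤ α * n / 100 := by
    rw [le_div_iff₀ (by norm_num)]
    nlinarith
  have hεα : ε * n ≤ α * n / 1000 := by
    rw [le_div_iff₀ (by norm_num)]
    nlinarith
  have hα1n : α * n ≤ n := mul_le_of_le_one_left hn0.le hα1
  set m := ⌊μ * n⌋₊ with hm
  have hm40 : 40 ≤ m := Nat.le_floor (by exact_mod_cast hμn)
  have hmle : (m : ℝ) ≤ μ * n := Nat.floor_le (by positivity)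
  have hbm : ⌊β * n⌋₊ ≤ m := Nat.floor_le_floor (by gcongr)
  have hMle : (⌊4 * ν * n⌋₊ : ℝ) ≤ 4 * ν * n := Nat.floor_le (by positivity)
  have hMge := Nat.lt_floor_add_one (4 * ν * n)
  set M := ⌊4 * ν * n⌋₊
  have hrge := Nat.le_ceil (ε * n)
  have hrle := Nat.ceil_lt_add_one (show 0 ≤ ε * n by positivity)
  have hRle : (⌊α * n / 50⌋₊ : ℝ) ≤ α * n / 50 := Nat.floor_le (by positivity)
  have hRge := Nat.lt_floor_add_one (α * n / 50)
  set R := ⌊α * n / 50⌋₊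
  have hrich : D.Rich M 35 := by
    refine hD.rich hG hα1 hMle hrge ?_ ?_ (by norm_num) (R := R) ?_
    · linarith
    · linarith
    · have hlog0 : 0 < Real.log n := lt_of_lt_of_le (by positivity) hlog
      have h1 : (n : ℝ) / Real.log n ≤ n * α ^ 2 / 10000000 := by
        rw [div_le_iff₀ hlog0]
        rw [div_le_iff₀ (by positivity)] at hlog
        nlinarith
      have h2 : α * n / 100 ≤ R := by linarith
      have h3 : (n : ℝ) / 2 ≤ n - M := by linarith
      have h5 : 0 ≤ (n : ℝ) - M := by linarith
      have h4 : (α * n / 100) ^ 2 ≤ (R : ℝ) ^ 2 := by gcongr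
      have hpos : 0 < (n : ℝ) ^ 3 * α ^ 2 := by positivity
      calc ((35 : ℕ) : ℝ) * (4 * (n / Real.log n)) * n ^ 2
          ≤ ((35 : ℕ) : ℝ) * (4 * (n * α ^ 2 / 10000000)) * n ^ 2 := by gcongr
        _ = (n ^ 3 * α ^ 2) * (140 / 10000000) := by push_cast; ring
        _ < (n ^ 3 * α ^ 2) * (1 / 20000) := mul_lt_mul_of_pos_left (by norm_num) hpos
        _ = (n / 2) * (α * n / 100) ^ 2 := by ring
        _ ≤ ((n : ℝ) - M) * R ^ 2 := by gcongr
  -- The forbidden budget: `ν n` outside `V'` or `C'`, at most `0.9 ν n` for `9000 * m`, and at most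
  -- `0.75 ν n` for 3000, all within `4 ν n`.
  have hsmall : ∀ {a b c : ℕ}, a = n → (1 - ν) * n ≤ (b : ℝ) → c + b = a →
      c + 9000 * m + 3000 ≤ M := by
    intro a b c ha hb hc
    have h1 : (c : ℝ) + b = n := by rw [← ha]; exact_mod_cast hc
    have h2 : ((c + 9000 * m + 3000 : ℕ) : ℝ) < M + 1 := by
      push_cast
      linarith
    exact Nat.lt_succ_iff.1 (by exact_mod_cast h2)
  refine hrich.hasAbsorber hm40 hX hV' (by omega) (by omega) ?_
    (hsmall hD.card_verts hV'c (Finset.card_sdiff_add_card_eq_card hV'))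
    (hsmall hD.card_colors hC'c (Finset.card_sdiff_add_card_eq_card hC')) hk o
  have : ((4 * m : ℕ) : ℝ) ≤ V'.card := by
    push_cast
    linarith
  exact_mod_cast this
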